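/- Let $M$ be a smooth $n$-dimensional manifold (Hausdorff, second countable, without boundary). Let $X:\mathbb R\times M\to TM$, $X_t:=X(t,\cdot)$, be a smooth time-dependent vector field that is complete: every Cauchy problem $\dot\gamma(t)=X_t(\gamma(t))$, $\gamma(t_0)=q_0$ has a solution on all of $\mathbb R$. Let $\phi^{t,s}:M\to M$ map $q$ to the value at time $t$ of the solution with $\gamma(s)=q$. A density on an $n$-dimensional real vector space $V$ is a function $\psi:V^n\to\mathbb R$ with $\psi(Tv_1,\dots,Tv_n)=|\det T|\,\psi(v_1,\dots,v_n)$ for all linear $T:V\to V$; it is positive if it is positive on all linearly independent $n$-tuples. Let $\mathcal DM=\bigsqcup_{q}\mathcal D(T_qM)$ be the density bundle, a smooth line bundle over $M$. The lift of a diffeomorphism $F:M\to M$ is the map $\hat F:\mathcal DM\to\mathcal DM$ that sends $\psi\in\mathcal D(T_qM)$ to the density $(v_1,\dots,v_n)\mapsto\psi(dF^{-1}v_1,\dots,dF^{-1}v_n)$ on $T_{F(q)}M$. A smooth time-dependent flow on a manifold $N$ is a family $\{\Phi^{t,s}\}_{t,s\in\mathbb R}$ of maps $N\to N$, jointly smooth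 in $(t,s,p)$, with $\Phi^{t,t}=\mathrm{id}$ and $\Phi^{t,s}\circ\Phi^{s,r}=\Phi^{t,r}$; its infinitesimal generator is $Y_t(p)=\frac{d}{ds}\big|_{s=t}\Phi^{s,t}(p)$. 1. The maps $\phi^{t,s}$ are diffeomorphisms and form a smooth time-dependent flow on $M$, and their lifts $\widehat{\phi^{t,s}}$ form a smooth time-dependent flow on $\mathcal DM$. The latter has an infinitesimal generator $\hat X$, which is a smooth time-dependent vector field on $\mathcal DM$, and the curves $t\mapsto\widehat{\phi^{t,s}}(\psi)$ are integral curves of $\hat X$. 2. Let $\mu$ be a smooth positive density on $M$. For each $t$ the divergence $\operatorname{div}_\mu X_t$, defined by $\mathcal L_{X_t}\mu=\operatorname{div}_\mu X_t\cdot\mu$ with $\mathcal L_{Y}\mu=\frac{d}{d\tau}\big|_{\tau=0}(\theta_Y^\tau)^*\mu$ for the local flow $\theta_Y$ of $Y$, exists and is smooth in $(t,q)$. The map $\Psi_\mu:\mathbb R\times M\to\mathcal DM$, $(a,q)\mapsto a\mu_q$, is a diffeomorphism, and in this trivialization the generator is $$\hat X_t:(a,q)\mapsto\bigl(-a\operatorname{div}_\mu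 X_t(q),\;X_t(q)\bigr),$$ that is, $d(\Psi_\mu)_{(a,q)}\bigl(-a\operatorname{div}_\mu X_t(q),X_t(q)\bigr)=\hat X_t(a\mu_q)$. 3. Let moreover $\rho_0\in C^\infty(M)$. There is a unique function $\rho:\mathbb R\times M\to\mathbb R$, $\rho_t:=\rho(t,\cdot)$, with $\rho_t\mu=(\phi^{0,t})^*(\rho_0\mu)$ for all $t$; it is smooth, and for all $t\in\mathbb R$, $q\in M$, $$\rho_t(\phi^{t,0}(q))=\exp\Bigl(-\int_0^t\operatorname{div}_\mu X_s(\phi^{s,0}(q))\,ds\Bigr)\rho_0(q).$$ Consequently, if $\rho_0(q)>0$ then $\rho_t(\phi^{t,0}(q))>0$ and $$\log\rho_t(\phi^{t,0}(q))=\log\rho_0(q)-\int_0^t\operatorname{div}_\mu X_s(\phi^{s,0}(q))\,ds .$$ -/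

import Mathlib

open Set Bundle Manifold
open scoped ContDiff
noncomputable section

/-- Densities on an `n`-dimensional real vector space `V`: functions `μ` of `n` vectors with
`μ (T v₁, …, T vₙ) = |det T| μ (v₁, …, vₙ)` for every linear map `T : V → V`. -/
def Density (n : ℕ) (V : Type*) [AddCommGroup V] [Module ℝ V] :
    Submodule ℝ ((Fin n → V) → ℝ) where
  carrier := {μ | ∀ (T : V →ₗ[ℝ] V) (v : Fin n → V),
    μ (fun i => T (v i)) = |LinearMap.det T| * μ v}
  add_mem' := by
    intro μ ν hμ hν T v
    simp only [Pi.add_apply, hμ T v, hν T v, mul_add]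
  zero_mem' := by
    intro T v
    simp
  smul_mem' := by
    intro c μ hμ T v
    simp only [Pi.smul_apply, smul_eq_mul, hμ T v]
    ring

namespace Density

variable {n : ℕ} {V W : Type*} [AddCommGroup V] [Module ℝ V] [AddCommGroup W] [Module ℝ W]

instance : CoeFun (Density n V) (fun _ => (Fin n → V) → ℝ) := ⟨fun μ => μ.1⟩

@[ext] theorem ext {μ ν : Density n V} (h : ∀ v, μ v = ν v) : μ = ν :=
  Subtype.ext (funext h)

theorem map_apply (μ : Density n V) (T : V →ₗ[ℝ] V) (v : Fin n → V) :
    μ (fun i => T (v i)) = |LinearMap.det T| * μ v := μ.2 T v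

@[simp] theorem add_apply (μ ν : Density n V) (v : Fin n → V) : (μ + ν) v = μ v + ν v := rfl

@[simp] theorem smul_apply (c : ℝ) (μ : Density n V) (v : Fin n → V) : (c • μ) v = c * μ v := rfl

theorem apply_eq (μ : Density n V) (e : Module.Basis (Fin n) ℝ V) (v : Fin n → V) :
    μ v = |e.det v| * μ e := by
  have h := map_apply μ (e.constr ℝ v) e
  simp only [Module.Basis.constr_basis] at h
  have h2 := e.det_comp (e.constr ℝ v) e
  rw [e.det_self, mul_one] at h2
  have h3 : (⇑(e.constr ℝ v) ∘ ⇑e) = v := by ext i; simp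
  rw [h3] at h2
  rw [h2]; exact h

/-- The density `|e.det|`, whose value on the basis `e` is `1`. -/
def ofBasis (e : Module.Basis (Fin n) ℝ V) : Density n V :=
  ⟨fun v => |e.det v|, fun T v => by
    have := e.det_comp T v
    rw [← abs_mul, ← this]; rfl⟩

@[simp] theorem ofBasis_apply (e : Module.Basis (Fin n) ℝ V) (v : Fin n → V) :
    ofBasis e v = |e.det v| := rfl

/-- A density is positive when it is positive on every linearly independent tuple. -/
def IsPositive (μ : Density n V) : Prop :=
  ∀ v : Fin n → V, LinearIndependent ℝ v → 0 < μ v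

/-- The pullback `ψ ↦ ψ (A ·, …, A ·)` of densities along a linear map between
`n`-dimensional spaces. -/
def comap [FiniteDimensional ℝ V] [FiniteDimensional ℝ W]
    (hV : Module.finrank ℝ V = n) (hW : Module.finrank ℝ W = n)
    (A : V →ₗ[ℝ] W) (μ : Density n W) : Density n V :=
  ⟨fun v => μ (fun i => A (v i)), fun T v => by
    have b := Module.finBasisOfFinrankEq ℝ V hV
    have e := Module.finBasisOfFinrankEq ℝ W hW
    have key : ∀ v : Fin n → V,
        e.det (fun i => A (v i)) = e.det.compLinearMap A b * b.det v := by
      intro v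
      have := congrArg (fun f => f v) ((e.det.compLinearMap A).eq_smul_basis_det b)
      simpa using this
    have hT : b.det (fun i => T (v i)) = LinearMap.det T * b.det v := b.det_comp T v
    show μ (fun i => A (T (v i))) = |LinearMap.det T| * μ (fun i => A (v i))
    rw [apply_eq μ e (fun i => A (T (v i))), apply_eq μ e (fun i => A (v i)),
      key (fun i => T (v i)), key v, hT, abs_mul, abs_mul, abs_mul]
    ring⟩

@[simp] theorem comap_apply [FiniteDimensional ℝ V] [FiniteDimensional ℝ W]
    (hV : Module.finrank ℝ V = n) (hW : Module.finrank ℝ W = n)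
    (A : V →ₗ[ℝ] W) (μ : Density n W) (v : Fin n → V) :
    comap hV hW A μ v = μ (fun i => A (v i)) := rfl

/-- Evaluation on a basis identifies the space of densities with `ℝ`. -/
def evalBasis (e : Module.Basis (Fin n) ℝ V) : Density n V ≃ₗ[ℝ] ℝ where
  toFun μ := μ e
  invFun c := c • ofBasis e
  map_add' _ _ := rfl
  map_smul' _ _ := rfl
  left_inv μ := by
    ext v
    rw [apply_eq μ e v]
    simp [mul_comm]
  right_inv c := by simp [e.det_self]

end Density


section Bundle

variable (n : ℕ) (M : Type*) [TopologicalSpace M] [ChartedSpace (EuclideanSpace ℝ (Fin n)) M]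

instance TangentSpace.finiteDimensional_euclidean (q : M) :
    FiniteDimensional ℝ (TangentSpace (𝓡 n) q) :=
  inferInstanceAs (FiniteDimensional ℝ (EuclideanSpace ℝ (Fin n)))

variable {M} in
theorem finrank_tangentSpace_euclidean (q : M) :
    Module.finrank ℝ (TangentSpace (𝓡 n) q) = n :=
  finrank_euclideanSpace_fin (𝕜 := ℝ) (n := n)

/-- The standard basis of `ℝⁿ`. -/
abbrev stdBasis : Module.Basis (Fin n) ℝ (EuclideanSpace ℝ (Fin n)) :=
  (EuclideanSpace.basisFun (Fin n) ℝ).toBasis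

/-- The fibre `𝒟(T_q M)` of the density bundle. -/
abbrev DensityFiber (q : M) : Type := Density n (TangentSpace (𝓡 n) q)

/-- The total space `𝒟M` of the density bundle. -/
abbrev DensityBundle : Type _ := TotalSpace ℝ (DensityFiber n M)

variable [IsManifold (𝓡 n) ∞ M]

variable {M} in
/-- The frame of `T_q M` read off from a local trivialization of the tangent bundle; for the
trivialization attached to a chart it is the coordinate frame. -/
def tangentFrame
    (t : Trivialization (EuclideanSpace ℝ (Fin n))
      (π (EuclideanSpace ℝ (Fin n)) (TangentSpace (𝓡 n) : M → Type _)))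
    [MemTrivializationAtlas t] (q : M) (hq : q ∈ t.baseSet) :
    Module.Basis (Fin n) ℝ (TangentSpace (𝓡 n) q) :=
  (stdBasis n).map (t.continuousLinearEquivAt ℝ q hq).symm.toLinearEquiv

open Classical in
variable {M} in
/-- The local trivialization `ψ ↦ ψ(∂₁, …, ∂ₙ)` of the density bundle. -/
def densityPretrivialization
    (t : Trivialization (EuclideanSpace ℝ (Fin n))
      (π (EuclideanSpace ℝ (Fin n)) (TangentSpace (𝓡 n) : M → Type _)))
    [MemTrivializationAtlas t] :
    Pretrivialization ℝ (π ℝ (DensityFiber n M)) where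
  toFun p := ⟨p.1, if h : p.1 ∈ t.baseSet then p.2 (tangentFrame n t p.1 h) else 0⟩
  invFun p := ⟨p.1, if h : p.1 ∈ t.baseSet then
    p.2 • Density.ofBasis (tangentFrame n t p.1 h) else 0⟩
  source := TotalSpace.proj ⁻¹' t.baseSet
  target := t.baseSet ×ˢ univ
  map_source' := fun ⟨_, _⟩ h => ⟨h, mem_univ _⟩
  map_target' := fun ⟨_, _⟩ h => h.1
  left_inv' := fun ⟨x, ψ⟩ h => by
    have h : x ∈ t.baseSet := h
    simp only [h, dif_pos]
    congr 1
    exact (Density.evalBasis (tangentFrame n t x h)).symm_apply_apply ψ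
  right_inv' := fun ⟨x, c⟩ ⟨h, _⟩ => by
    have h : x ∈ t.baseSet := h
    simp only [h, dif_pos]
    congr 1
    exact (Density.evalBasis (tangentFrame n t x h)).apply_symm_apply c
  open_target := t.open_baseSet.prod isOpen_univ
  baseSet := t.baseSet
  open_baseSet := t.open_baseSet
  source_eq := rfl
  target_eq := rfl
  proj_toFun _ _ := rfl

variable {M} in
theorem densityPretrivialization_apply
    (t : Trivialization (EuclideanSpace ℝ (Fin n))
      (π (EuclideanSpace ℝ (Fin n)) (TangentSpace (𝓡 n) : M → Type _)))
    [MemTrivializationAtlas t] (q : M) (hq : q ∈ t.baseSet) (ψ : DensityFiber n M q) :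
    densityPretrivialization n t ⟨q, ψ⟩ = (q, ψ (tangentFrame n t q hq)) :=
  Prod.ext rfl (dif_pos hq)

variable {M} in
theorem densityPretrivialization_symm_apply
    (t : Trivialization (EuclideanSpace ℝ (Fin n))
      (π (EuclideanSpace ℝ (Fin n)) (TangentSpace (𝓡 n) : M → Type _)))
    [MemTrivializationAtlas t] (q : M) (hq : q ∈ t.baseSet) (c : ℝ) :
    (densityPretrivialization n t).symm q c = c • Density.ofBasis (tangentFrame n t q hq) := by
  rw [Pretrivialization.symm_apply _ hq]
  exact eq_of_heq ((cast_heq _ _).trans (heq_of_eq (dif_pos hq)))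

variable {M} in
/-- Coordinate changes of the density bundle: multiplication by `|det|` of the coordinate change of
the tangent bundle. -/
def densityCoordChange
    (t t' : Trivialization (EuclideanSpace ℝ (Fin n))
      (π (EuclideanSpace ℝ (Fin n)) (TangentSpace (𝓡 n) : M → Type _)))
    [MemTrivializationAtlas t] [MemTrivializationAtlas t'] (q : M) : ℝ →L[ℝ] ℝ :=
  |(stdBasis n).det (fun i => t'.coordChangeL ℝ t q (stdBasis n i))| • ContinuousLinearMap.id ℝ ℝ

variable {M} in
theorem densityCoordChange_apply
    (t t' : Trivialization (EuclideanSpace ℝ (Fin n))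
      (π (EuclideanSpace ℝ (Fin n)) (TangentSpace (𝓡 n) : M → Type _)))
    [MemTrivializationAtlas t] [MemTrivializationAtlas t'] (q : M)
    (hq : q ∈ t.baseSet ∩ t'.baseSet) (c : ℝ) :
    densityCoordChange n t t' q c =
      (densityPretrivialization n t' ⟨q, (densityPretrivialization n t).symm q c⟩).2 := by
  rw [densityPretrivialization_apply n t' q hq.2, densityPretrivialization_symm_apply n t q hq.1]
  simp only [densityCoordChange, Density.smul_apply, Density.ofBasis_apply]
  have : (tangentFrame n t q hq.1).det (tangentFrame n t' q hq.2) =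
      (stdBasis n).det (fun i => t'.coordChangeL ℝ t q (stdBasis n i)) := by
    rw [tangentFrame, Module.Basis.det_map]
    congr 1
    funext i
    rw [← Trivialization.comp_continuousLinearEquivAt_eq_coord_change _ _ hq.symm]
    rfl
  rw [this]
  simp [mul_comm]

variable {M} in
theorem contMDiffOn_densityCoordChange
    (t t' : Trivialization (EuclideanSpace ℝ (Fin n))
      (π (EuclideanSpace ℝ (Fin n)) (TangentSpace (𝓡 n) : M → Type _)))
    [MemTrivializationAtlas t] [MemTrivializationAtlas t'] :
    ContMDiffOn (𝓡 n) 𝓘(ℝ, ℝ →L[ℝ] ℝ) ∞ (densityCoordChange n t t')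
      (t.baseSet ∩ t'.baseSet) := by
  have h1 := (contMDiffOn_coordChangeL (n := ∞) (IB := 𝓡 n) t' t)
  rw [inter_comm] at h1
  intro q hq
  have hne : (stdBasis n).det (fun i => t'.coordChangeL ℝ t q (stdBasis n i)) ≠ 0 := by
    exact ((stdBasis n).isUnit_det
      ((stdBasis n).map (t'.coordChangeL ℝ t q).toLinearEquiv)).ne_zero
  have h2 : ContDiff ℝ ∞ (fun L : EuclideanSpace ℝ (Fin n) →L[ℝ] EuclideanSpace ℝ (Fin n) =>
      (stdBasis n).det (fun i => L (stdBasis n i))) := by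
    have : (fun L : EuclideanSpace ℝ (Fin n) →L[ℝ] EuclideanSpace ℝ (Fin n) =>
      (stdBasis n).det (fun i => L (stdBasis n i))) = fun L =>
        ∑ σ : Equiv.Perm (Fin n), ((Equiv.Perm.sign σ : ℤ) : ℝ) *
          ∏ i, (L (stdBasis n i)) (σ i) := by
      funext L
      rw [Module.Basis.det_apply, Matrix.det_apply']
      rfl
    rw [this]
    fun_prop
  have h3 : ContDiffAt ℝ ∞ (fun L : EuclideanSpace ℝ (Fin n) →L[ℝ] EuclideanSpace ℝ (Fin n) =>
      |(stdBasis n).det (fun i => L (stdBasis n i))| • ContinuousLinearMap.id ℝ ℝ)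
      (t'.coordChangeL ℝ t q : EuclideanSpace ℝ (Fin n) →L[ℝ] EuclideanSpace ℝ (Fin n)) := by
    have h4 : ContDiffAt ℝ ∞
        (fun L : EuclideanSpace ℝ (Fin n) →L[ℝ] EuclideanSpace ℝ (Fin n) =>
          |(stdBasis n).det (fun i => L (stdBasis n i))|)
        (t'.coordChangeL ℝ t q : EuclideanSpace ℝ (Fin n) →L[ℝ] EuclideanSpace ℝ (Fin n)) :=
      ContDiffAt.comp (g := fun x : ℝ => |x|) _ (contDiffAt_abs hne) h2.contDiffAt
    exact h4.smul contDiffAt_const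
  exact h3.contMDiffAt.comp_contMDiffWithinAt q (h1 q hq)

/-- The vector prebundle structure of `𝒟M`. -/
def densityPrebundle : VectorPrebundle ℝ ℝ (DensityFiber n M) where
  pretrivializationAtlas := {e | ∃ (t : Trivialization (EuclideanSpace ℝ (Fin n))
      (π (EuclideanSpace ℝ (Fin n)) (TangentSpace (𝓡 n) : M → Type _)))
    (_ : MemTrivializationAtlas t), e = densityPretrivialization n t}
  pretrivialization_linear' := by
    rintro _ ⟨t, ht, rfl⟩
    refine ⟨fun q hq => ⟨fun ψ χ => ?_, fun c ψ => ?_⟩⟩ <;>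
    · simp only [densityPretrivialization_apply n t q hq]
      rfl
  pretrivializationAt q :=
    densityPretrivialization n (trivializationAt (EuclideanSpace ℝ (Fin n)) (TangentSpace (𝓡 n)) q)
  mem_base_pretrivializationAt q :=
    mem_baseSet_trivializationAt (EuclideanSpace ℝ (Fin n)) (TangentSpace (𝓡 n)) q
  pretrivialization_mem_atlas q := ⟨_, inferInstance, rfl⟩
  exists_coordChange := by
    rintro _ ⟨t, ht, rfl⟩ _ ⟨t', ht', rfl⟩
    exact ⟨densityCoordChange n t t', (contMDiffOn_densityCoordChange n t t').continuousOn,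
      densityCoordChange_apply n t t'⟩
  totalSpaceMk_isInducing := by
    intro q
    let e := tangentFrame n
      (trivializationAt (EuclideanSpace ℝ (Fin n)) (TangentSpace (𝓡 n)) q) q
      (mem_baseSet_trivializationAt _ _ _)
    have : FiniteDimensional ℝ (DensityFiber n M q) :=
      (Density.evalBasis e).symm.finiteDimensional
    have h : Topology.IsInducing fun ψ => (q, (Density.evalBasis e).toContinuousLinearEquiv ψ) :=
      Topology.isInducing_const_prod.mpr
        (Density.evalBasis e).toContinuousLinearEquiv.toHomeomorph.isInducing
    convert! h using 1
    funext ψ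
    exact densityPretrivialization_apply n _ q _ ψ

instance densityBundleTopology : TopologicalSpace (DensityBundle n M) :=
  (densityPrebundle n M).totalSpaceTopology

instance densityFiberBundle : FiberBundle ℝ (DensityFiber n M) :=
  (densityPrebundle n M).toFiberBundle

instance densityVectorBundle : VectorBundle ℝ ℝ (DensityFiber n M) :=
  (densityPrebundle n M).toVectorBundle

instance densityPrebundle_isContMDiff : (densityPrebundle n M).IsContMDiff (𝓡 n) ∞ where
  exists_contMDiffCoordChange := by
    rintro _ ⟨t, ht, rfl⟩ _ ⟨t', ht', rfl⟩
    exact ⟨densityCoordChange n t t', contMDiffOn_densityCoordChange n t t',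
      densityCoordChange_apply n t t'⟩

instance densityContMDiffVectorBundle : ContMDiffVectorBundle ∞ ℝ (DensityFiber n M) (𝓡 n) :=
  (densityPrebundle n M).contMDiffVectorBundle (𝓡 n)

end Bundle

section Flows

variable {E : Type*} [NormedAddCommGroup E] [NormedSpace ℝ E] {H : Type*} [TopologicalSpace H]
  (I : ModelWithCorners ℝ E H) {N : Type*} [TopologicalSpace N] [ChartedSpace H N]

/-- A time-dependent vector field is smooth when it is smooth as a map `ℝ × N → TN`. -/
def IsSmoothTimeDepField [IsManifold I ∞ N] (X : ℝ → ∀ q : N, TangentSpace I q) : Prop :=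
  ContMDiff (𝓘(ℝ, ℝ).prod I) I.tangent ∞
    (fun p : ℝ × N => (⟨p.2, X p.1 p.2⟩ : TangentBundle I N))

/-- `γ : ℝ → N` satisfies `γ'(t) = X_t(γ(t))` for all `t`. -/
def IsTimeDepIntegralCurve (X : ℝ → ∀ q : N, TangentSpace I q) (γ : ℝ → N) : Prop :=
  ∀ t : ℝ, HasMFDerivAt 𝓘(ℝ, ℝ) I γ t ((1 : ℝ →L[ℝ] ℝ).smulRight (X t (γ t)))

/-- Every Cauchy problem `γ' = X_t(γ)`, `γ(t₀) = q₀` has a solution defined on all of `ℝ`. -/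
def IsCompleteField (X : ℝ → ∀ q : N, TangentSpace I q) : Prop :=
  ∀ (t₀ : ℝ) (q₀ : N), ∃ γ : ℝ → N, γ t₀ = q₀ ∧ IsTimeDepIntegralCurve I X γ

/-- `timeDepFlow I X hX t₁ t₀ q` is the value at time `t₁` of the solution of the Cauchy problem
with initial time `t₀` and initial point `q`. (On a Hausdorff manifold without boundary the solution
is unique when `X` is smooth.) -/
def timeDepFlow (X : ℝ → ∀ q : N, TangentSpace I q) (hX : IsCompleteField I X)
    (t₁ t₀ : ℝ) (q : N) : N :=
  Classical.choose (hX t₀ q) t₁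

/-- A smooth (global) time-dependent flow. -/
structure IsSmoothTimeDepFlow (Φ : ℝ → ℝ → N → N) : Prop where
  smooth : ContMDiff (𝓘(ℝ, ℝ).prod (𝓘(ℝ, ℝ).prod I)) I ∞
    (fun p : ℝ × ℝ × N => Φ p.1 p.2.1 p.2.2)
  self : ∀ (t : ℝ) (q : N), Φ t t q = q
  comp : ∀ (t₂ t₁ t₀ : ℝ) (q : N), Φ t₂ t₁ (Φ t₁ t₀ q) = Φ t₂ t₀ q

/-- `Y` is the infinitesimal generator of `Φ`: `Y_t(q) = d/ds|_{s = t} Φ^{s,t}(q)`. The base point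
is written `Φ t t q`, which equals `q` for a flow. -/
def IsInfinitesimalGenerator (Φ : ℝ → ℝ → N → N) (Y : ℝ → ∀ q : N, TangentSpace I q) : Prop :=
  ∀ (t : ℝ) (q : N), HasMFDerivAt 𝓘(ℝ, ℝ) I (fun s => Φ s t q) t
    ((1 : ℝ →L[ℝ] ℝ).smulRight (Y t (Φ t t q)))

open Classical in
/-- The local flow of an autonomous vector field: `localFlow I X t q` is the value at time `t` of
the maximal integral curve of `X` starting at `q` (and `q` if that curve does not reach time `t`).
-/
def localFlow (X : ∀ q : N, TangentSpace I q) (t : ℝ) (q : N) : N :=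
  if h : ∃ γ : ℝ → N, γ 0 = q ∧ ∃ a b : ℝ, (0 : ℝ) ∈ Ioo a b ∧ t ∈ Ioo a b ∧
      IsMIntegralCurveOn (I := I) γ X (Ioo a b)
  then Classical.choose h t else q

end Flows

section DensityCalculus

variable {n : ℕ} {M : Type*} [TopologicalSpace M] [ChartedSpace (EuclideanSpace ℝ (Fin n)) M]
  {N : Type*} [TopologicalSpace N] [ChartedSpace (EuclideanSpace ℝ (Fin n)) N]

/-- The pullback density `(F^*ν)_p (v₁, …, vₙ) = ν_{F p} (dF_p v₁, …, dF_p vₙ)`. -/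
def densityPullback (F : M → N) (ν : ∀ q : N, DensityFiber n N q) (p : M) : DensityFiber n M p :=
  Density.comap (finrank_tangentSpace_euclidean n p) (finrank_tangentSpace_euclidean n (F p))
    (mfderiv (𝓡 n) (𝓡 n) F p).toLinearMap (ν (F p))

/-- A smooth section of the density bundle. -/
def IsSmoothDensity [IsManifold (𝓡 n) ∞ M] (μ : ∀ q : M, DensityFiber n M q) : Prop :=
  ContMDiff (𝓡 n) ((𝓡 n).prod 𝓘(ℝ, ℝ)) ∞ (fun q : M => (⟨q, μ q⟩ : DensityBundle n M))

/-- A section of the density bundle that is a positive density at every point. -/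
def IsPositiveDensity (μ : ∀ q : M, DensityFiber n M q) : Prop :=
  ∀ q : M, Density.IsPositive (μ q)

/-- The lift `𝒟M → 𝒟N` of a diffeomorphism `F : M → N`: it sends `ψ ∈ 𝒟(T_q M)` to the density
`(v₁, …, vₙ) ↦ ψ (dF⁻¹ v₁, …, dF⁻¹ vₙ)` on `T_{F q} N`. -/
def densityLift [IsManifold (𝓡 n) ∞ M] [IsManifold (𝓡 n) ∞ N] (F : M ≃ₘ⟮𝓡 n, 𝓡 n⟯ N)
    (ψ : DensityBundle n M) : DensityBundle n N :=
  ⟨F ψ.1, Density.comap (finrank_tangentSpace_euclidean n (F ψ.1))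
    (finrank_tangentSpace_euclidean n ψ.1)
    (F.mfderivToContinuousLinearEquiv (by simp) ψ.1).symm.toLinearEquiv.toLinearMap ψ.2⟩

/-- `(L_X μ)_q = c μ_q`, where `L_X μ = d/dt|_{t = 0} (θ_t)^* μ` is the Lie derivative of `μ` along
`X`, with `θ` the local flow of `X`. -/
def IsDivergenceAt (μ : ∀ q : M, DensityFiber n M q) (X : ∀ q : M, TangentSpace (𝓡 n) q)
    (q : M) (c : ℝ) : Prop :=
  ∀ v : Fin n → TangentSpace (𝓡 n) q,
    HasDerivAt (fun t : ℝ => densityPullback (localFlow (𝓡 n) X t) μ q v) (c * μ q v) 0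

/-- The divergence of `X` with respect to `μ`: the function with `L_X μ = div_μ X · μ`. -/
def divergence (μ : ∀ q : M, DensityFiber n M q) (X : ∀ q : M, TangentSpace (𝓡 n) q) (q : M) : ℝ :=
  Classical.epsilon (fun c : ℝ => IsDivergenceAt μ X q c)

end DensityCalculus

end

/-! Smoothness of flows comes from the implicit function theorem in C([-2, 2], E). The time-ε map of
a field f is the time-1 map of εf, and a solution for εf starting at x is a zero α of α - x - ε∫₀
f∘α. At ε = 0 the derivative in α is the identity, and the expression is smooth because α ↦ f∘α is
(`ContinuousMap.contDiff_postcomp`). Charts carry the local solution to a manifold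
(`exists_contMDiffAt_local_solution`), uniqueness of integral curves identifies it with the flow
near time 0, and the group law spreads smoothness to all times
(`contMDiff_flow_of_isMIntegralCurve`). The suspension (1, X) on ℝ × M reduces time-dependent fields
to this case.

The lift of φ^{t,s} is pullback by the differential of φ^{s,t}. In local frames it multiplies the
coordinate of a density by the absolute value of a nonvanishing determinant, so the lifts are
jointly smooth; their flow laws are the chain rule.

A positive density μ turns the lifts into a scalar cocycle j: the lift of φ^{t,s} sends μ_q to
j(t,s,q) times μ at φ^{t,s}(q). The initial derivative of F_τ^*μ depends only on the initial
velocity of the family F_τ (`exists_hasDerivAt_densityPullback`). Hence the divergence, defined by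
the local flow of the frozen field X_t, can be computed from φ^{τ,t}, and the derivative of j(τ,t,q)
at τ = t is -div_μ X_t(q) (`hasDerivAt_flowJacobian_self`). This is the fibre component of the
generator. The cocycle law makes it a linear equation for j, solved by the exponential
(`flowJacobian_eq_exp`), and ρ_t is (ρ₀ · j(t,0,·)) ∘ φ^{0,t}. -/

noncomputable section

/-! ### Smoothness of the composition operator on continuous functions. -/

section PostComposition

open Topology

variable {K : Type*} [TopologicalSpace K] [CompactSpace K]

/-- A continuous bilinear map, applied pointwise to continuous functions. -/
def ContinuousMap.bilinearCLM (K : Type*) [TopologicalSpace K] [CompactSpace K]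
    {F E G : Type*} [NormedAddCommGroup F] [NormedSpace ℝ F] [NormedAddCommGroup E]
    [NormedSpace ℝ E] [NormedAddCommGroup G] [NormedSpace ℝ G] (B : F →L[ℝ] E →L[ℝ] G) :
    C(K, F) →L[ℝ] C(K, E) →L[ℝ] C(K, G) :=
  LinearMap.mkContinuous₂
    (LinearMap.mk₂ ℝ (fun (L : C(K, F)) (β : C(K, E)) =>
        (⟨fun k => B (L k) (β k), by fun_prop⟩ : C(K, G)))
      (fun _ _ _ => by ext; simp) (fun _ _ _ => by ext; simp)
      (fun _ _ _ => by ext; simp) (fun _ _ _ => by ext; simp))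
    ‖B‖ (fun L β => by
      rw [ContinuousMap.norm_le _ (by positivity)]
      intro k
      refine (B.le_opNorm₂ _ _).trans ?_
      gcongr
      exacts [L.norm_coe_le_norm k, β.norm_coe_le_norm k])

variable {E G : Type*} [NormedAddCommGroup E] [NormedSpace ℝ E]
  [NormedAddCommGroup G] [NormedSpace ℝ G]

set_option synthInstance.maxHeartbeats 200000 in
theorem ContinuousMap.hasFDerivAt_postcomp (f : C(E, G)) (f' : C(E, E →L[ℝ] G))
    (hf : ∀ x, HasFDerivAt f (f' x) x) (α : C(K, E)) :
    HasFDerivAt (fun α : C(K, E) => f.comp α) (ContinuousMap.bilinearCLM K (.id ℝ (E →L[ℝ] G)) (f'.comp α)) α := by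
  rw [hasFDerivAt_iff_isLittleO_nhds_zero, Asymptotics.isLittleO_iff]
  intro c hc
  have hS : IsCompact (range α) := isCompact_range α.continuous
  -- E need not be locally compact, so f' is not uniformly continuous near the image of α. It is
  -- enough that one δ serves all centres α k in the compact image, with the second point arbitrary;
  -- the mean value inequality on each ball around α k then gives the remainder bound.
  have hu := hS.uniformContinuousAt_of_continuousAt f' (fun x _ => f'.continuous.continuousAt)
    (Metric.dist_mem_uniformity hc)
  obtain ⟨δ, hδ, hu⟩ := Metric.mem_uniformity_dist.1 hu
  filter_upwards [Metric.ball_mem_nhds (0 : C(K, E)) hδ] with β hβ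
  rw [mem_ball_zero_iff] at hβ
  rw [ContinuousMap.norm_le _ (by positivity)]
  intro k
  have hβk : ‖β k‖ < δ := (β.norm_coe_le_norm k).trans_lt hβ
  have := (convex_ball (α k) δ).norm_image_sub_le_of_norm_hasFDerivWithin_le' (f := f)
    (f' := f') (φ := f' (α k)) (C := c) (x := α k) (y := α k + β k)
    (fun x _ => (hf x).hasFDerivWithinAt) (fun x hx => by
      have := hu (a := α k) (b := x) (by rwa [dist_comm]) ⟨k, rfl⟩
      rw [← dist_eq_norm, dist_comm]
      exact le_of_lt this) (Metric.mem_ball_self hδ) (by simpa using hβk)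
  rw [add_sub_cancel_left] at this
  exact this.trans (mul_le_mul_of_nonneg_left (β.norm_coe_le_norm k) hc.le)

end PostComposition

-- The derivative is again composition, with f', followed by a fixed continuous bilinear map, so the
-- order drops by one. The induction replaces G by E →L[ℝ] G; this is why G is quantified inside and
-- shares the universe of E.
set_option synthInstance.maxHeartbeats 200000 in
theorem ContinuousMap.contDiff_postcomp_nat.{u} {K : Type*} [TopologicalSpace K] [CompactSpace K]
    {E : Type u} [NormedAddCommGroup E] [NormedSpace ℝ E] (k : ℕ) :
    ∀ {G : Type u} [NormedAddCommGroup G] [NormedSpace ℝ G] (f : C(E, G)),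
      ContDiff ℝ k f → ContDiff ℝ k (fun α : C(K, E) => f.comp α) := by
  induction k with
  | zero =>
    intro G _ _ f _
    exact contDiff_zero.2 (ContinuousMap.continuous_postcomp f)
  | succ k ih =>
    intro G _ _ f hf
    rw [Nat.cast_succ] at hf ⊢
    have hd := contDiff_succ_iff_fderiv.1 hf
    let f' : C(E, E →L[ℝ] G) := ⟨fderiv ℝ f, hd.2.2.continuous⟩
    have h : ∀ α : C(K, E), HasFDerivAt (fun α : C(K, E) => f.comp α)
        (ContinuousMap.bilinearCLM K (.id ℝ (E →L[ℝ] G)) (f'.comp α)) α :=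
      ContinuousMap.hasFDerivAt_postcomp f f' (fun x => (hd.1 x).hasFDerivAt)
    refine contDiff_succ_iff_fderiv.2 ⟨fun α => (h α).differentiableAt, by simp, ?_⟩
    rw [show fderiv ℝ (fun α : C(K, E) => f.comp α) =
      fun α => ContinuousMap.bilinearCLM K (.id ℝ (E →L[ℝ] G)) (f'.comp α) from funext fun α => (h α).fderiv]
    exact (ContinuousMap.bilinearCLM K (.id ℝ (E →L[ℝ] G))).contDiff.comp (ih f' hd.2.2)

theorem ContinuousMap.contDiff_postcomp.{u} {K : Type*} [TopologicalSpace K] [CompactSpace K]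
    {E G : Type u} [NormedAddCommGroup E] [NormedSpace ℝ E]
    [NormedAddCommGroup G] [NormedSpace ℝ G] (f : C(E, G)) (hf : ContDiff ℝ ∞ f) :
    ContDiff ℝ ∞ (fun α : C(K, E) => f.comp α) :=
  contDiff_infty.2 fun k =>
    ContinuousMap.contDiff_postcomp_nat k f (contDiff_infty.1 hf k)

/-! ### Local solutions in a Banach space by the implicit function theorem. -/

section LocalFlow

open Topology intervalIntegral MeasureTheory

variable {E : Type*} [NormedAddCommGroup E] [NormedSpace ℝ E]

/-- The integration operator `α ↦ ∫₀ˢ α` on `C([-2, 2], E)`. -/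
def integralCLM (E : Type*) [NormedAddCommGroup E] [NormedSpace ℝ E] :
    C(Icc (-2 : ℝ) 2, E) →L[ℝ] C(Icc (-2 : ℝ) 2, E) :=
  LinearMap.mkContinuous
    { toFun := fun α => ⟨fun s => ∫ τ in (0 : ℝ)..s, IccExtend (by norm_num) α τ, by
        have : Continuous fun s : ℝ => ∫ τ in (0 : ℝ)..s, IccExtend (by norm_num) α τ :=
          continuous_primitive (fun a b =>
            (α.continuous.Icc_extend' (h := by norm_num)).intervalIntegrable a b) 0
        exact this.comp continuous_subtype_val⟩
      map_add' := fun α β => by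
        ext s
        exact integral_add ((α.continuous.Icc_extend' (h := by norm_num)).intervalIntegrable _ _)
          ((β.continuous.Icc_extend' (h := by norm_num)).intervalIntegrable _ _)
      map_smul' := fun c α => by
        ext s
        exact integral_smul c _ }
    2 (fun α => by
      rw [ContinuousMap.norm_le _ (by positivity)]
      intro s
      refine (norm_integral_le_of_norm_le_const (C := ‖α‖)
        (fun τ _ => α.norm_coe_le_norm _)).trans ?_
      rw [sub_zero, mul_comm]
      exact mul_le_mul_of_nonneg_right (abs_le.2 s.2) (norm_nonneg _))

/-- The parameter p = (ε, x) contains the time as a scaling of the field, so evaluation at the fixed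
time 1, interior to (-2, 2), gives smoothness jointly in time and initial point. The clause on U
keeps whole curves near x₀, hence inside a chart. -/
theorem exists_contDiffAt_local_solution [CompleteSpace E] {f : E → E} (hf : ContDiff ℝ ∞ f)
    (x₀ : E) : ∃ c : ℝ × E → ℝ → E,
      ContDiffAt ℝ ∞ (fun p => c p 1) (0, x₀) ∧ c (0, x₀) 1 = x₀ ∧
      (∀ U ∈ 𝓝 x₀, ∀ᶠ p in 𝓝 ((0 : ℝ), x₀), ∀ s, c p s ∈ U) ∧
      ∀ᶠ p in 𝓝 ((0 : ℝ), x₀), c p 0 = p.2 ∧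
        ∀ s ∈ Ioo (-2 : ℝ) 2, HasDerivAt (c p) (p.1 • f (c p s)) s := by
  let fc : C(E, E) := ⟨f, hf.continuous⟩
  let k : E →L[ℝ] C(Icc (-2 : ℝ) 2, E) := ContinuousLinearMap.const ℝ (Icc (-2 : ℝ) 2)
  let F : (ℝ × E) × C(Icc (-2 : ℝ) 2, E) → C(Icc (-2 : ℝ) 2, E) := fun u =>
    u.2 - k u.1.2 - u.1.1 • integralCLM E (fc.comp u.2)
  have hN : ContDiff ℝ ∞ (fun α : C(Icc (-2 : ℝ) 2, E) => fc.comp α) :=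
    ContinuousMap.contDiff_postcomp fc hf
  have hF : ContDiff ℝ ∞ F := by
    have h1 : ContDiff ℝ ∞ (fun u : (ℝ × E) × C(Icc (-2 : ℝ) 2, E) => fc.comp u.2) :=
      hN.comp contDiff_snd
    fun_prop
  let u₀ : (ℝ × E) × C(Icc (-2 : ℝ) 2, E) := ((0, x₀), k x₀)
  have hne : (∞ : WithTop ℕ∞) ≠ 0 := by simp
  -- The integral term carries the factor ε and vanishes at ε = 0, leaving α ↦ α - x₀; no
  -- contraction estimate is needed.
  have hinv : fderiv ℝ F u₀ ∘L .inr ℝ (ℝ × E) C(Icc (-2 : ℝ) 2, E) =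
      ContinuousLinearMap.id ℝ _ := by
    have h1 : HasFDerivAt (fun α => F ((0, x₀), α))
        (fderiv ℝ F u₀ ∘L .inr ℝ (ℝ × E) C(Icc (-2 : ℝ) 2, E)) (k x₀) :=
      ((hF.differentiable hne) u₀).hasFDerivAt.comp (k x₀) (hasFDerivAt_prodMk_right (0, x₀) (k x₀))
    have h2 : (fun α => F ((0, x₀), α)) = fun α => α - k x₀ := by
      funext α
      simp [F]
    rw [h2] at h1
    exact h1.unique ((hasFDerivAt_id _).sub_const _)
  have hi : (fderiv ℝ F u₀ ∘L .inr ℝ (ℝ × E) C(Icc (-2 : ℝ) 2, E)).IsInvertible := by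
    rw [hinv]
    exact ⟨ContinuousLinearEquiv.refl ℝ _, rfl⟩
  have cdf : ContDiffAt ℝ ∞ F u₀ := hF.contDiffAt
  let A := cdf.implicitFunction hne hi
  have hA : ContDiffAt ℝ ∞ A (0, x₀) := cdf.contDiffAt_implicitFunction hne hi
  have hA0 : A (0, x₀) = k x₀ := cdf.implicitFunction_apply_self hne hi
  have hAe : ∀ᶠ p in 𝓝 ((0 : ℝ), x₀), F (p, A p) = F u₀ :=
    cdf.eventually_apply_implicitFunction hne hi
  refine ⟨fun p => IccExtend (by norm_num) (A p), ?_, by simp [hA0, k, IccExtend], ?_, ?_⟩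
  · let e : C(Icc (-2 : ℝ) 2, E) →L[ℝ] E :=
      ContinuousMap.evalCLM ℝ (projIcc (-2 : ℝ) 2 (by norm_num) 1)
    exact e.contDiff.contDiffAt.comp _ hA
  · intro U hU
    obtain ⟨r, hr, hrU⟩ := Metric.mem_nhds_iff.1 hU
    have := hA.continuousAt.eventually (Metric.ball_mem_nhds _ hr)
    filter_upwards [this] with p hp s
    apply hrU
    rw [hA0] at hp
    exact (ContinuousMap.dist_apply_le_dist (f := A p) (g := k x₀) _).trans_lt hp
  · filter_upwards [hAe] with p hp
    have hF0 : F u₀ = 0 := by simp [F, u₀]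
    rw [hF0] at hp
    have hsol : ∀ s : Icc (-2 : ℝ) 2, A p s =
        p.2 + p.1 • ∫ τ in (0 : ℝ)..s, f (IccExtend (by norm_num) (A p) τ) := by
      intro s
      have := congrArg (fun α : C(Icc (-2 : ℝ) 2, E) => α s) hp
      simp only [F, ContinuousMap.sub_apply, ContinuousMap.zero_apply, sub_sub, sub_eq_zero] at this
      exact this
    have hval : ∀ s ∈ Icc (-2 : ℝ) 2, IccExtend (by norm_num) (A p) s =
        p.2 + p.1 • ∫ τ in (0 : ℝ)..s, f (IccExtend (by norm_num) (A p) τ) := by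
      intro s hs
      rw [← hsol ⟨s, hs⟩, IccExtend_of_mem _ _ hs]
    refine ⟨by rw [hval 0 (by norm_num)]; simp, fun s hs => ?_⟩
    have hcont : Continuous fun τ => f (IccExtend (by norm_num) (A p) τ) :=
      hf.continuous.comp ((A p).continuous.Icc_extend' (h := by norm_num))
    have hd := ((hcont.integral_hasStrictDerivAt 0 s).hasDerivAt.const_smul p.1).const_add p.2
    refine hd.congr_of_eventuallyEq ?_
    filter_upwards [Icc_mem_nhds hs.1 hs.2] with τ hτ
    exact hval τ hτ

end LocalFlow

/-! ### Local solutions on a manifold. -/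

section ManifoldLocalFlow

open Topology

variable {E : Type*} [NormedAddCommGroup E] [NormedSpace ℝ E] {H : Type*} [TopologicalSpace H]
  {I : ModelWithCorners ℝ E H} {N : Type*} [TopologicalSpace N] [ChartedSpace H N]
  [IsManifold I ∞ N]

/-- The manifold derivative reads the curve in the preferred chart of its current point, not in the
chart at x₀. The tangent coordinate change is the derivative of the transition map between the two.
-/
theorem hasMFDerivAt_extChartAt_symm_comp [I.Boundaryless] {x₀ : N} {α : ℝ → E} {t : ℝ}
    (hα : α t ∈ (extChartAt I x₀).target)
    (w : TangentSpace I ((extChartAt I x₀).symm (α t)))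
    (h : HasDerivAt α (tangentCoordChange I ((extChartAt I x₀).symm (α t)) x₀
      ((extChartAt I x₀).symm (α t)) w) t) :
    HasMFDerivAt 𝓘(ℝ, ℝ) I (fun s => (extChartAt I x₀).symm (α s)) t
      ((1 : ℝ →L[ℝ] ℝ).smulRight w) := by
  let xₜ : N := (extChartAt I x₀).symm (α t)
  have hft1 : xₜ ∈ (extChartAt I x₀).source := (extChartAt I x₀).map_target hα
  have hft2 := mem_extChartAt_source (I := I) xₜ
  let w' : E := w
  have hd : HasDerivAt ((extChartAt I xₜ ∘ (extChartAt I x₀).symm) ∘ α) w' t := by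
    have hw : w' = tangentCoordChange I x₀ xₜ xₜ (tangentCoordChange I xₜ x₀ xₜ w') := by
      rw [tangentCoordChange_comp (x := x₀) ⟨⟨hft2, hft1⟩, hft2⟩,
        tangentCoordChange_self (I := I) (x := xₜ) (z := xₜ) (v := w') hft2]
    rw [hw]
    refine HasFDerivAt.comp_hasDerivAt _ ?_ h
    apply HasFDerivWithinAt.hasFDerivAt (s := range I) _ (by simp [I.range_eq_univ])
    rw [← (extChartAt I x₀).right_inv hα]
    exact hasFDerivWithinAt_tangentCoordChange ⟨hft1, hft2⟩
  have hf : HasFDerivAt ((extChartAt I xₜ ∘ (extChartAt I x₀).symm) ∘ α)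
      ((1 : ℝ →L[ℝ] ℝ).smulRight w') t :=
    hd.hasFDerivAt.congr_fderiv (by ext; simp)
  exact ⟨(continuousAt_extChartAt_symm'' hα).comp h.continuousAt, hf.hasFDerivWithinAt⟩

theorem contDiffOn_vectorField_inChart {V : ∀ q : N, TangentSpace I q} [I.Boundaryless]
    (hV : ContMDiff I I.tangent ∞ (fun q => (⟨q, V q⟩ : TangentBundle I N))) (x₀ : N) :
    ContDiffOn ℝ ∞ (fun y => tangentCoordChange I ((extChartAt I x₀).symm y) x₀
      ((extChartAt I x₀).symm y) (V ((extChartAt I x₀).symm y))) (extChartAt I x₀).target := by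
  have h1 : ContMDiffOn I 𝓘(ℝ, E) ∞
      (fun q => (trivializationAt E (TangentSpace I) x₀ ⟨q, V q⟩).2) (extChartAt I x₀).source := by
    have := (Trivialization.contMDiffOn_iff (n := ∞) (IB := I) (IM := I)
      (e := trivializationAt E (TangentSpace I) x₀) (s := (extChartAt I x₀).source)
      (f := fun q => (⟨q, V q⟩ : TangentBundle I N)) (fun q hq => by
        rw [TangentBundle.trivializationAt_source]
        simpa using hq)).1 hV.contMDiffOn
    exact this.2
  have h2 := h1.comp (contMDiffOn_extChartAt_symm (I := I) (n := ∞) x₀)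
    (fun y hy => (extChartAt I x₀).map_target hy)
  exact contMDiffOn_iff_contDiffOn.1 h2

theorem exists_contMDiffAt_local_solution [FiniteDimensional ℝ E] [I.Boundaryless]
    {V : ∀ q : N, TangentSpace I q}
    (hV : ContMDiff I I.tangent ∞ (fun q => (⟨q, V q⟩ : TangentBundle I N))) (x₀ : N) :
    ∃ c : ℝ × N → ℝ → N, ContMDiffAt (𝓘(ℝ, ℝ).prod I) I ∞ (fun p => c p 1) (0, x₀) ∧
      ∀ᶠ p in 𝓝 ((0 : ℝ), x₀), c p 0 = p.2 ∧
        ∀ s ∈ Ioo (-2 : ℝ) 2, HasMFDerivAt 𝓘(ℝ, ℝ) I (c p) s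
          ((1 : ℝ →L[ℝ] ℝ).smulRight (p.1 • V (c p s))) := by
  have : CompleteSpace E := FiniteDimensional.complete ℝ E
  set φ := extChartAt I x₀ with hφ
  set y₀ := φ x₀ with hy₀
  set v : E → E := fun y => tangentCoordChange I (φ.symm y) x₀ (φ.symm y) (V (φ.symm y)) with hv
  have hvs : ContDiffOn ℝ ∞ v φ.target := contDiffOn_vectorField_inChart hV x₀
  have hto : IsOpen φ.target := isOpen_extChartAt_target x₀
  have hy₀t : y₀ ∈ φ.target := mem_extChartAt_target x₀
  obtain ⟨r, hr, hrt⟩ := Metric.nhds_basis_closedBall.mem_iff.1 (hto.mem_nhds hy₀t)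
  -- Cutting off inside the chart target makes the field smooth on all of E. The solutions used stay
  -- in the ball of radius r / 2, where the cutoff is 1.
  let b : ContDiffBump y₀ := ⟨r / 2, r, by positivity, by linarith⟩
  have hf : ContDiff ℝ ∞ (fun y => b y • v y) := by
    refine contMDiff_iff_contDiff.1 (contMDiff_of_tsupport fun y hy => ContDiffAt.contMDiffAt ?_)
    have hy' : y ∈ φ.target := by
      apply hrt
      have := tsupport_smul_subset_left b v hy
      rwa [b.tsupport_eq] at this
    exact b.contDiff.contDiffAt.smul (hvs.contDiffAt (hto.mem_nhds hy'))
  obtain ⟨c, hc1, hc2, hc3, hc4⟩ := exists_contDiffAt_local_solution hf y₀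
  have hcont : ContinuousAt (fun p : ℝ × N => (p.1, φ p.2)) (0, x₀) :=
    continuousAt_fst.prodMk
      (ContinuousAt.comp (g := φ) (x := ((0 : ℝ), x₀)) (continuousAt_extChartAt x₀)
        continuousAt_snd)
  refine ⟨fun p s => φ.symm (c (p.1, φ p.2) s), ?_, ?_⟩
  · have h1 : ContMDiffAt (𝓘(ℝ, ℝ).prod I) 𝓘(ℝ, ℝ × E) ∞ (fun p : ℝ × N => (p.1, φ p.2))
        (0, x₀) :=
      contMDiffAt_fst.prodMk_space (ContMDiffAt.comp (g := φ) ((0 : ℝ), x₀)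
        (contMDiffAt_extChartAt (n := ∞)) contMDiffAt_snd)
    have h2 : ContMDiffAt (𝓘(ℝ, ℝ).prod I) 𝓘(ℝ, E) ∞ (fun p : ℝ × N => c (p.1, φ p.2) 1)
        (0, x₀) := ContMDiffAt.comp (g := fun p => c p 1) _ hc1.contMDiffAt h1
    have h3 : ContMDiffAt 𝓘(ℝ, E) I ∞ φ.symm (c (0, y₀) 1) := by
      rw [hc2]
      exact (contMDiffOn_extChartAt_symm x₀).contMDiffAt (hto.mem_nhds hy₀t)
    exact ContMDiffAt.comp (g := φ.symm) ((0 : ℝ), x₀) h3 h2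
  · have h1 := hcont.eventually hc4
    have h2 := hcont.eventually (hc3 _ (Metric.closedBall_mem_nhds y₀ (half_pos hr)))
    have h3 : ∀ᶠ p : ℝ × N in 𝓝 (0, x₀), p.2 ∈ φ.source :=
      continuousAt_snd.eventually (extChartAt_source_mem_nhds x₀)
    filter_upwards [h1, h2, h3] with p hp1 hp2 hp3
    refine ⟨by rw [hp1.1]; exact φ.left_inv hp3, fun s hs => ?_⟩
    have hmem : c (p.1, φ p.2) s ∈ φ.target :=
      hrt (Metric.closedBall_subset_closedBall (by linarith) (hp2 s))
    have hd := hp1.2 s hs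
    have hone : b (c (p.1, φ p.2) s) = 1 := b.one_of_mem_closedBall (hp2 s)
    apply hasMFDerivAt_extChartAt_symm_comp hmem
    rw [hone, one_smul] at hd
    exact hd.congr_deriv (ContinuousLinearMap.map_smul (tangentCoordChange I
      (φ.symm (c (p.1, φ p.2) s)) x₀ (φ.symm (c (p.1, φ p.2) s))) p.1 _).symm

end ManifoldLocalFlow

/-! ### Smoothness of the flow of an autonomous field. -/

section FlowSmoothness

open Topology

variable {E : Type*} [NormedAddCommGroup E] [NormedSpace ℝ E] [FiniteDimensional ℝ E]
  {H : Type*} [TopologicalSpace H]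
  {I : ModelWithCorners ℝ E H} [I.Boundaryless] {N : Type*} [TopologicalSpace N] [ChartedSpace H N]
  [IsManifold I ∞ N] {V : ∀ q : N, TangentSpace I q}

/-- `θ t q` is the value at time `t` of every integral curve of `V` that starts at `q` and is
defined on an open interval containing `0` and `t`. -/
def FollowsIntegralCurves (I : ModelWithCorners ℝ E H) (V : ∀ q : N, TangentSpace I q)
    (θ : ℝ → N → N) : Prop :=
  ∀ (γ : ℝ → N) (a b t : ℝ), 0 ∈ Ioo a b → t ∈ Ioo a b →
    IsMIntegralCurveOn (I := I) γ V (Ioo a b) → θ t (γ 0) = γ t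

theorem FollowsIntegralCurves.exists_curve {θ : ℝ → N → N} (hθ : FollowsIntegralCurves I V θ)
    (hV : ContMDiff I I.tangent ∞ (fun q => (⟨q, V q⟩ : TangentBundle I N))) (x : N) :
    ∃ γ : ℝ → N, γ 0 = x ∧ IsMIntegralCurveAt (I := I) γ V 0 ∧
      (fun t => θ t x) =ᶠ[𝓝 0] γ := by
  have : CompleteSpace E := FiniteDimensional.complete ℝ E
  obtain ⟨γ, hγ0, hγ⟩ := exists_isMIntegralCurveAt_of_contMDiffAt_boundaryless (I := I) 0
    ((hV x).of_le (m := 1) (by simp))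
  obtain ⟨ε, hε, hγε⟩ := isMIntegralCurveAt_iff'.1 hγ
  rw [Real.ball_eq_Ioo, zero_sub, zero_add] at hγε
  refine ⟨γ, hγ0, hγ, ?_⟩
  filter_upwards [Ioo_mem_nhds (neg_lt_zero.2 hε) hε] with t ht
  rw [← hγ0]
  exact hθ γ _ _ t ⟨neg_lt_zero.2 hε, hε⟩ ht hγε

theorem FollowsIntegralCurves.zero_apply {θ : ℝ → N → N} (hθ : FollowsIntegralCurves I V θ)
    (hV : ContMDiff I I.tangent ∞ (fun q => (⟨q, V q⟩ : TangentBundle I N))) (x : N) :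
    θ 0 x = x := by
  obtain ⟨γ, h0, -, h⟩ := hθ.exists_curve hV x
  exact h.eq_of_nhds.trans h0

theorem FollowsIntegralCurves.hasMFDerivAt_zero {θ : ℝ → N → N}
    (hθ : FollowsIntegralCurves I V θ)
    (hV : ContMDiff I I.tangent ∞ (fun q => (⟨q, V q⟩ : TangentBundle I N))) (x : N) :
    HasMFDerivAt 𝓘(ℝ, ℝ) I (fun t => θ t x) 0 ((1 : ℝ →L[ℝ] ℝ).smulRight (V x)) := by
  obtain ⟨γ, h0, h1, h⟩ := hθ.exists_curve hV x
  subst h0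
  exact h1.hasMFDerivAt.congr_of_eventuallyEq h

variable [T2Space N]

/-- Near (0, x₀) the value θ ε x is the time-1 value of the rescaled solution for εV. The hypothesis
covers both the local flow and a global one, so both get smoothness from one argument. -/
theorem FollowsIntegralCurves.contMDiffAt {θ : ℝ → N → N} (hθ : FollowsIntegralCurves I V θ)
    (hV : ContMDiff I I.tangent ∞ (fun q => (⟨q, V q⟩ : TangentBundle I N))) (x₀ : N) :
    ContMDiffAt (𝓘(ℝ, ℝ).prod I) I ∞ (fun p : ℝ × N => θ p.1 p.2) (0, x₀) := by
  have : CompleteSpace E := FiniteDimensional.complete ℝ E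
  obtain ⟨c, hc, hce⟩ := exists_contMDiffAt_local_solution hV x₀
  refine hc.congr_of_eventuallyEq ?_
  filter_upwards [hce] with p hp
  obtain ⟨ε, x⟩ := p
  obtain ⟨hp0, hp⟩ := hp
  have hcurve : IsMIntegralCurveOn (I := I) (c (ε, x)) (ε • V) (Ioo (-2) 2) :=
    fun s hs => (hp s hs).hasMFDerivWithinAt
  simp only at hp0
  -- For ε = 0 time cannot be rescaled by ε⁻¹; the field is then zero and uniqueness makes the curve
  -- constant. Otherwise t ↦ c (t / ε) follows V on |t| < 2|ε| and reaches the time-1 value at t =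
  -- ε.
  rcases eq_or_ne ε 0 with rfl | hε
  · have hz : ContMDiff I I.tangent 1
        (fun q => (⟨q, ((0 : ℝ) • V) q⟩ : TangentBundle I N)) := by
      simp only [zero_smul]
      exact contMDiff_zeroSection (n := 1) (IB := I) ℝ (TangentSpace I : N → Type _)
    have hconst : IsMIntegralCurve (I := I) (fun _ => x) ((0 : ℝ) • V) :=
      isMIntegralCurve_const (by simp)
    have := isMIntegralCurveOn_Ioo_eqOn_of_contMDiff_boundaryless (t₀ := 0) (by norm_num) hz
      hcurve (hconst.isMIntegralCurveOn _) hp0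
    exact (hθ.zero_apply hV x).trans (this (x := 1) (by norm_num)).symm
  · have h1 := (isMIntegralCurveOn_comp_mul_ne_zero (inv_ne_zero hε)).2 hcurve
    rw [smul_smul, inv_mul_cancel₀ hε, one_smul] at h1
    have hpos : 0 < |ε| := abs_pos.2 hε
    have h2 := hθ _ (-(2 * |ε|)) (2 * |ε|) ε ⟨by linarith, by linarith⟩
      ⟨by linarith [neg_abs_le ε], by linarith [le_abs_self ε]⟩ (h1.mono fun t ht => by
        have : |t * ε⁻¹| < 2 := by
          rw [abs_mul, abs_inv, ← div_eq_mul_inv, div_lt_iff₀ hpos]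
          exact abs_lt.2 ht
        exact abs_lt.1 this)
    simpa [hp0, hε] using h2

/-- The curve chosen inside `localFlow` may depend on t. Uniqueness on the intersection of the two
intervals makes the choice irrelevant. -/
theorem followsIntegralCurves_localFlow
    (hV : ContMDiff I I.tangent ∞ (fun q => (⟨q, V q⟩ : TangentBundle I N))) :
    FollowsIntegralCurves I V (localFlow I V) := by
  intro γ a b t h0 ht hγ
  have : CompleteSpace E := FiniteDimensional.complete ℝ E
  have h : ∃ γ' : ℝ → N, γ' 0 = γ 0 ∧ ∃ a b : ℝ, (0 : ℝ) ∈ Ioo a b ∧ t ∈ Ioo a b ∧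
      IsMIntegralCurveOn (I := I) γ' V (Ioo a b) := ⟨γ, rfl, a, b, h0, ht, hγ⟩
  rw [localFlow, dif_pos h]
  obtain ⟨h1, a', b', h0', ht', hγ'⟩ := Classical.choose_spec h
  have hsub : Ioo (max a a') (min b b') = Ioo a b ∩ Ioo a' b' := (Ioo_inter_Ioo).symm
  have := isMIntegralCurveOn_Ioo_eqOn_of_contMDiff_boundaryless (t₀ := 0)
    (hsub ▸ ⟨h0, h0'⟩) (hV.of_le (by simp))
    (hγ'.mono (hsub ▸ inter_subset_right)) (hγ.mono (hsub ▸ inter_subset_left)) h1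
  exact this (hsub ▸ ⟨ht, ht'⟩)

theorem followsIntegralCurves_of_isMIntegralCurve {θ : ℝ → N → N}
    (hV : ContMDiff I I.tangent ∞ (fun q => (⟨q, V q⟩ : TangentBundle I N)))
    (h0 : ∀ x, θ 0 x = x) (hθ : ∀ x, IsMIntegralCurve (I := I) (fun t => θ t x) V) :
    FollowsIntegralCurves I V θ := by
  intro γ a b t h0' ht hγ
  have : CompleteSpace E := FiniteDimensional.complete ℝ E
  exact isMIntegralCurveOn_Ioo_eqOn_of_contMDiff_boundaryless (t₀ := 0) h0' (hV.of_le (by simp))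
    ((hθ (γ 0)).isMIntegralCurveOn _) hγ (h0 _) ht

/-- The flow of a complete smooth vector field is smooth. -/
theorem contMDiff_flow_of_isMIntegralCurve {θ : ℝ → N → N}
    (hV : ContMDiff I I.tangent ∞ (fun q => (⟨q, V q⟩ : TangentBundle I N)))
    (h0 : ∀ x, θ 0 x = x) (hθ : ∀ x, IsMIntegralCurve (I := I) (fun t => θ t x) V) :
    ContMDiff (𝓘(ℝ, ℝ).prod I) I ∞ (fun p : ℝ × N => θ p.1 p.2) := by
  have : CompleteSpace E := FiniteDimensional.complete ℝ E
  have hadd : ∀ s t x, θ s (θ t x) = θ (s + t) x := by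
    intro s t x
    have := isMIntegralCurve_Ioo_eq_of_contMDiff_boundaryless (t₀ := 0) (hV.of_le (by simp))
      (hθ (θ t x)) ((hθ x).comp_add t) (by simp [h0])
    exact congrFun this s
  have hloc := (followsIntegralCurves_of_isMIntegralCurve hV h0 hθ).contMDiffAt hV
  -- Being C^k at a point is an open condition for finite k, which the connectedness argument in
  -- time requires.
  rw [contMDiff_infty]
  intro k
  have : IsManifold I k N := IsManifold.of_le (n := ∞) (by exact_mod_cast le_top)
  rintro ⟨t₁, x⟩
  set A : Set ℝ := {t | ContMDiffAt (𝓘(ℝ, ℝ).prod I) I k (fun p : ℝ × N => θ p.1 p.2) (t, x)}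
  suffices A = univ from (this ▸ mem_univ t₁ : t₁ ∈ A)
  have hopen : IsOpen A := by
    rw [isOpen_iff_mem_nhds]
    intro t ht
    have h := (contMDiffAt_iff_contMDiffAt_nhds (by simp)).1 ht
    exact (Continuous.prodMk_left x).continuousAt.eventually h
  -- For t in the closure, take s in A so close to t that θ is C^k at (t - s, θ s x), a point near
  -- (0, θ t x). Then θ τ y = θ (τ - s) (θ s y) is a composition of C^k maps near (t, x).
  refine IsClopen.eq_univ ⟨isClosed_of_closure_subset fun t ht => ?_, hopen⟩
    ⟨0, (hloc x).of_le (by exact_mod_cast le_top)⟩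
  have hcont : Continuous fun t => θ t x := (hθ x).continuous
  have hk : ∀ᶠ p in 𝓝 ((0 : ℝ), θ t x),
      ContMDiffAt (𝓘(ℝ, ℝ).prod I) I k (fun p : ℝ × N => θ p.1 p.2) p :=
    (contMDiffAt_iff_contMDiffAt_nhds (by simp)).1
      ((hloc (θ t x)).of_le (by exact_mod_cast le_top))
  have hlim : ContinuousAt (fun s => (t - s, θ s x)) t := by fun_prop
  have hk' := hlim.eventually (by simpa using hk)
  obtain ⟨s, hs, hsA⟩ := (mem_closure_iff_nhds.1 ht _ hk')
  have hs' : ContMDiffAt (𝓘(ℝ, ℝ).prod I) I k (fun p : ℝ × N => θ p.1 p.2) (t - s, θ s x) := hs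
  have hsx : ContMDiffAt I I k (θ s) x :=
    ContMDiffAt.comp (g := fun p : ℝ × N => θ p.1 p.2) x hsA
      (contMDiffAt_const.prodMk contMDiffAt_id)
  have h2 : ContMDiffAt (𝓘(ℝ, ℝ).prod I) (𝓘(ℝ, ℝ).prod I) k
      (fun p : ℝ × N => (p.1 - s, θ s p.2)) (t, x) :=
    (contMDiffAt_fst.sub contMDiffAt_const).prodMk
      (ContMDiffAt.comp (g := θ s) (t, x) hsx contMDiffAt_snd)
  have h3 := ContMDiffAt.comp (g := fun p : ℝ × N => θ p.1 p.2) (t, x) hs' h2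
  refine h3.congr_of_eventuallyEq (Filter.Eventually.of_forall fun p => ?_)
  simp [hadd]

end FlowSmoothness

/-! ### Time-dependent fields through the suspension. -/

section TimeDependentFlow

open Topology

variable {E : Type*} [NormedAddCommGroup E] [NormedSpace ℝ E] [FiniteDimensional ℝ E]
  {H : Type*} [TopologicalSpace H]
  {I : ModelWithCorners ℝ E H} [I.Boundaryless] {N : Type*} [TopologicalSpace N] [ChartedSpace H N]
  [IsManifold I ∞ N] {X : ℝ → ∀ q : N, TangentSpace I q}

/-- The suspension `(1, X)` of a time-dependent vector field. -/
def suspension (X : ℝ → ∀ q : N, TangentSpace I q) (p : ℝ × N) :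
    TangentSpace (𝓘(ℝ, ℝ).prod I) p :=
  ((1 : ℝ), X p.1 p.2)

omit [FiniteDimensional ℝ E] [I.Boundaryless] in
theorem contMDiff_suspension (hX : IsSmoothTimeDepField I X) :
    ContMDiff (𝓘(ℝ, ℝ).prod I) (𝓘(ℝ, ℝ).prod I).tangent ∞
      (fun p : ℝ × N => (⟨p, suspension X p⟩ : TangentBundle (𝓘(ℝ, ℝ).prod I) (ℝ × N))) := by
  have h1 : ContMDiff 𝓘(ℝ, ℝ) 𝓘(ℝ, ℝ).tangent ∞
      (fun t : ℝ => (⟨t, (1 : ℝ)⟩ : TangentBundle 𝓘(ℝ, ℝ) ℝ)) := by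
    exact contMDiff_vectorSpace_iff_contDiff.2 contDiff_const
  have h2 := (contMDiff_equivTangentBundleProd_symm (n := ∞) (I := 𝓘(ℝ, ℝ)) (M := ℝ)
    (I' := I) (M' := N)).comp ((h1.comp contMDiff_fst).prodMk hX)
  exact h2

omit [FiniteDimensional ℝ E] [I.Boundaryless] [IsManifold I ∞ N] in
theorem IsTimeDepIntegralCurve.isMIntegralCurve_suspension {γ : ℝ → N}
    (hγ : IsTimeDepIntegralCurve I X γ) (s : ℝ) :
    IsMIntegralCurve (I := 𝓘(ℝ, ℝ).prod I) (fun t => (s + t, γ (s + t))) (suspension X) := by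
  have h0 : IsMIntegralCurve (I := 𝓘(ℝ, ℝ).prod I) (fun t => (t, γ t)) (suspension X) := by
    intro t
    have := (hasMFDerivAt_id (I := 𝓘(ℝ, ℝ)) t).prodMk (hγ t)
    refine this.congr_mfderiv ?_
    ext1
    exact Prod.ext (one_smul ℝ (1 : ℝ)).symm rfl
  have := h0.comp_add s
  simpa [Function.comp_def, add_comm] using this

variable [T2Space N]

/-- The graphs t ↦ (t, γ t) are integral curves of the autonomous suspension through a common point,
so autonomous uniqueness applies. -/
theorem IsTimeDepIntegralCurve.eq (hX : IsSmoothTimeDepField I X) {γ γ' : ℝ → N}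
    (hγ : IsTimeDepIntegralCurve I X γ) (hγ' : IsTimeDepIntegralCurve I X γ') {t₀ : ℝ}
    (h : γ t₀ = γ' t₀) : γ = γ' := by
  have : CompleteSpace E := FiniteDimensional.complete ℝ E
  have := isMIntegralCurve_Ioo_eq_of_contMDiff_boundaryless (t₀ := t₀)
    ((contMDiff_suspension hX).of_le (by simp))
    (hγ.isMIntegralCurve_suspension 0) (hγ'.isMIntegralCurve_suspension 0) (by simp [h])
  funext t
  simpa using congrArg Prod.snd (congrFun this t)

omit [FiniteDimensional ℝ E] [I.Boundaryless] [IsManifold I ∞ N] [T2Space N] in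
theorem timeDepFlow_self (hc : IsCompleteField I X) (t : ℝ) (q : N) :
    timeDepFlow I X hc t t q = q :=
  (Classical.choose_spec (hc t q)).1

omit [FiniteDimensional ℝ E] [I.Boundaryless] [IsManifold I ∞ N] [T2Space N] in
theorem isTimeDepIntegralCurve_timeDepFlow (hc : IsCompleteField I X) (s : ℝ) (q : N) :
    IsTimeDepIntegralCurve I X (fun t => timeDepFlow I X hc t s q) :=
  (Classical.choose_spec (hc s q)).2

theorem timeDepFlow_comp (hX : IsSmoothTimeDepField I X) (hc : IsCompleteField I X)
    (t₂ t₁ t₀ : ℝ) (q : N) :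
    timeDepFlow I X hc t₂ t₁ (timeDepFlow I X hc t₁ t₀ q) = timeDepFlow I X hc t₂ t₀ q :=
  congrFun (IsTimeDepIntegralCurve.eq hX (isTimeDepIntegralCurve_timeDepFlow hc t₁ _)
    (isTimeDepIntegralCurve_timeDepFlow hc t₀ q) (timeDepFlow_self hc t₁ _)) t₂

/-- The flow of a complete smooth time-dependent vector field is a smooth time-dependent flow. -/
theorem isSmoothTimeDepFlow_timeDepFlow (hX : IsSmoothTimeDepField I X)
    (hc : IsCompleteField I X) : IsSmoothTimeDepFlow I (timeDepFlow I X hc) where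
  self := timeDepFlow_self hc
  comp := timeDepFlow_comp hX hc
  smooth := by
    -- The suspended flow sends (s, q) to (s + t, φ^{s+t,s}(q)). Running it for time t - s and
    -- projecting to N recovers φ^{t,s}.
    have h := contMDiff_flow_of_isMIntegralCurve (contMDiff_suspension hX)
      (θ := fun t p => (p.1 + t, timeDepFlow I X hc (p.1 + t) p.1 p.2))
      (fun p => by simp [timeDepFlow_self])
      (fun p => (isTimeDepIntegralCurve_timeDepFlow hc p.1 p.2).isMIntegralCurve_suspension p.1)
    have h1 : ContMDiff (𝓘(ℝ, ℝ).prod (𝓘(ℝ, ℝ).prod I)) (𝓘(ℝ, ℝ).prod (𝓘(ℝ, ℝ).prod I)) ∞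
        (fun p : ℝ × ℝ × N => (p.1 - p.2.1, p.2)) :=
      (contMDiff_fst.sub (contMDiff_fst.comp contMDiff_snd)).prodMk contMDiff_snd
    have h2 := contMDiff_snd.comp (h.comp h1)
    simpa [Function.comp_def] using h2

end TimeDependentFlow

/-! ### The infinitesimal generator of a time-dependent flow. -/

section FlowGenerator

open Topology

variable {E : Type*} [NormedAddCommGroup E] [NormedSpace ℝ E] {H : Type*} [TopologicalSpace H]
  {I : ModelWithCorners ℝ E H} {N : Type*} [TopologicalSpace N] [ChartedSpace H N]
  {Φ : ℝ → ℝ → N → N}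

/-- The infinitesimal generator of a time-dependent flow. -/
def flowGenerator (I : ModelWithCorners ℝ E H) (Φ : ℝ → ℝ → N → N) (t : ℝ) (p : N) :
    TangentSpace I p :=
  (mfderiv 𝓘(ℝ, ℝ) I (fun s => Φ s t p) t : ℝ →L[ℝ] E) 1

omit [TopologicalSpace N] [ChartedSpace H N] in
theorem tangentBundle_mk_eq [TopologicalSpace N] [ChartedSpace H N] {p q : N} (h : p = q) (w : E) :
    (⟨p, w⟩ : TangentBundle I N) = ⟨q, w⟩ := by
  subst h
  rfl

theorem IsSmoothTimeDepFlow.contMDiff_time (hΦ : IsSmoothTimeDepFlow I Φ) (t₀ : ℝ) (p : N) :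
    ContMDiff 𝓘(ℝ, ℝ) I ∞ (fun t => Φ t t₀ p) :=
  have h : ContMDiff 𝓘(ℝ, ℝ) (𝓘(ℝ, ℝ).prod (𝓘(ℝ, ℝ).prod I)) ∞ (fun t : ℝ => (t, t₀, p)) :=
    contMDiff_id.prodMk contMDiff_const
  hΦ.smooth.comp h

theorem IsSmoothTimeDepFlow.contMDiff_map (hΦ : IsSmoothTimeDepFlow I Φ) (t s : ℝ) :
    ContMDiff I I ∞ (Φ t s) :=
  have h : ContMDiff I (𝓘(ℝ, ℝ).prod (𝓘(ℝ, ℝ).prod I)) ∞ (fun p : N => (t, s, p)) :=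
    contMDiff_const.prodMk (contMDiff_const.prodMk contMDiff_id)
  hΦ.smooth.comp h

/-- Restart at time t: Φ^{t',s} = Φ^{t',t} ∘ Φ^{t,s}, so the velocity at t' = t is the generator at
the current point. -/
theorem IsSmoothTimeDepFlow.isTimeDepIntegralCurve (hΦ : IsSmoothTimeDepFlow I Φ)
    (s : ℝ) (p : N) : IsTimeDepIntegralCurve I (flowGenerator I Φ) (fun t => Φ t s p) := by
  intro t
  have h : (fun t' => Φ t' s p) = fun t' => Φ t' t (Φ t s p) := by
    funext t'
    rw [hΦ.comp]
  have h1 := ((hΦ.contMDiff_time t (Φ t s p)).mdifferentiable (by simp) t).hasMFDerivAt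
  have h2 : HasMFDerivAt 𝓘(ℝ, ℝ) I (fun t' => Φ t' t (Φ t s p)) t
      ((1 : ℝ →L[ℝ] ℝ).smulRight (flowGenerator I Φ t (Φ t s p))) := by
    refine h1.congr_mfderiv ?_
    ext1
    exact (one_smul ℝ (flowGenerator I Φ t (Φ t s p))).symm
  rw [← h] at h2
  exact h2

theorem IsSmoothTimeDepFlow.isInfinitesimalGenerator (hΦ : IsSmoothTimeDepFlow I Φ) :
    IsInfinitesimalGenerator I Φ (flowGenerator I Φ) :=
  fun t q => hΦ.isTimeDepIntegralCurve t q t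

theorem IsSmoothTimeDepFlow.isSmoothTimeDepField [IsManifold I ∞ N]
    (hΦ : IsSmoothTimeDepFlow I Φ) : IsSmoothTimeDepField I (flowGenerator I Φ) := by
  intro x₀
  have h1 : ContMDiff ((𝓘(ℝ, ℝ).prod I).prod 𝓘(ℝ, ℝ)) I ∞
      (Function.uncurry fun (x : ℝ × N) s => Φ s x.1 x.2) :=
    hΦ.smooth.comp (contMDiff_snd.prodMk contMDiff_fst)
  have h2 := ContMDiffAt.mfderiv (x₀ := x₀) (m := ∞) (fun (x : ℝ × N) s => Φ s x.1 x.2)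
    (fun x => x.1) h1.contMDiffAt contMDiffAt_fst (by simp)
  have h3 : ContMDiff 𝓘(ℝ, ℝ) 𝓘(ℝ, ℝ).tangent ∞
      (fun t : ℝ => (⟨t, (1 : ℝ)⟩ : TangentBundle 𝓘(ℝ, ℝ) ℝ)) :=
    contMDiff_vectorSpace_iff_contDiff.2 contDiff_const
  have h5 : ContMDiffAt (𝓘(ℝ, ℝ).prod I) 𝓘(ℝ, ℝ).tangent ∞
      (fun x : ℝ × N => (⟨x.1, (1 : ℝ)⟩ : TangentBundle 𝓘(ℝ, ℝ) ℝ)) x₀ :=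
    ContMDiffAt.comp x₀ h3.contMDiffAt contMDiffAt_fst
  have h6 : ContMDiff (𝓘(ℝ, ℝ).prod I) I ∞ (fun x : ℝ × N => Φ x.1 x.1 x.2) :=
    hΦ.smooth.comp (contMDiff_fst.prodMk contMDiff_id)
  have h4 := ContMDiffAt.clm_apply_of_inCoordinates (F₁ := ℝ) (E₁ := TangentSpace 𝓘(ℝ, ℝ))
    (F₂ := E) (E₂ := (TangentSpace I : N → Type _))
    (b₁ := fun x : ℝ × N => x.1) (b₂ := fun x : ℝ × N => Φ x.1 x.1 x.2)
    (ϕ := fun x => mfderiv 𝓘(ℝ, ℝ) I (fun s => Φ s x.1 x.2) x.1)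
    (v := fun _ => (1 : ℝ)) h2 h5 h6.contMDiffAt
  -- The differential takes values over Φ t t p; the flow axiom moves the vector to p without
  -- changing it as an element of E.
  refine h4.congr_of_eventuallyEq (Filter.Eventually.of_forall fun x => ?_)
  exact tangentBundle_mk_eq (hΦ.self x.1 x.2).symm _

end FlowGenerator

/-! ### Smooth families of densities and their pullbacks. -/

section DensityBundleSmoothness

open Topology

variable {n : ℕ} {M : Type*} [TopologicalSpace M] [ChartedSpace (EuclideanSpace ℝ (Fin n)) M]

theorem Module.Basis.det_ne_zero_of_linearIndependent {V : Type*} [AddCommGroup V] [Module ℝ V]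
    (e : Module.Basis (Fin n) ℝ V) {v : Fin n → V} (hv : LinearIndependent ℝ v) :
    e.det v ≠ 0 := by
  have : FiniteDimensional ℝ V := Module.Basis.finiteDimensional_of_finite e
  have h := e.isUnit_det (basisOfLinearIndependentOfCardEqFinrank' v hv
    (Module.finrank_eq_card_basis e).symm)
  rw [coe_basisOfLinearIndependentOfCardEqFinrank'] at h
  exact h.ne_zero

/-- Every tangent space is the model space by definition, so densities at propositionally equal
points can be compared on tuples without transport. -/
theorem densityBundle_mk_eq {p q : M} (h : p = q) {ψ : DensityFiber n M p}
    {χ : DensityFiber n M q}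
    (hv : ∀ v : Fin n → EuclideanSpace ℝ (Fin n), ψ.1 v = χ.1 v) :
    (⟨p, ψ⟩ : DensityBundle n M) = ⟨q, χ⟩ := by
  subst h
  congr 1
  exact Density.ext hv

variable [IsManifold (𝓡 n) ∞ M]

theorem trivializationAt_density_apply {q₀ q : M}
    (hq : q ∈ (trivializationAt (EuclideanSpace ℝ (Fin n)) (TangentSpace (𝓡 n)) q₀).baseSet)
    (ψ : DensityFiber n M q) :
    (trivializationAt ℝ (DensityFiber n M) q₀ ⟨q, ψ⟩).2 = ψ (tangentFrame n _ q hq) :=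
  congrArg Prod.snd (densityPretrivialization_apply n _ q hq ψ)

theorem contDiff_stdBasis_det : ContDiff ℝ ∞
    (fun L : EuclideanSpace ℝ (Fin n) →L[ℝ] EuclideanSpace ℝ (Fin n) =>
      (stdBasis n).det (fun i => L (stdBasis n i))) := by
  have : (fun L : EuclideanSpace ℝ (Fin n) →L[ℝ] EuclideanSpace ℝ (Fin n) =>
      (stdBasis n).det (fun i => L (stdBasis n i))) = fun L =>
        ∑ σ : Equiv.Perm (Fin n), ((Equiv.Perm.sign σ : ℤ) : ℝ) *
          ∏ i, (L (stdBasis n i)) (σ i) := by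
    funext L
    rw [Module.Basis.det_apply, Matrix.det_apply']
    rfl
  rw [this]
  fun_prop

variable {EP : Type*} [NormedAddCommGroup EP] [NormedSpace ℝ EP] {HP : Type*}
  [TopologicalSpace HP] {J : ModelWithCorners ℝ EP HP} {P : Type*} [TopologicalSpace P]
  [ChartedSpace HP P]

omit [TopologicalSpace P] in
theorem tangentFrame_det_inTangentCoordinates {f g : P → M}
    (A : P → EuclideanSpace ℝ (Fin n) →L[ℝ] EuclideanSpace ℝ (Fin n)) {x₀ x : P}
    (hf : f x ∈ (trivializationAt (EuclideanSpace ℝ (Fin n)) (TangentSpace (𝓡 n)) (f x₀)).baseSet)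
    (hg : g x ∈ (trivializationAt (EuclideanSpace ℝ (Fin n)) (TangentSpace (𝓡 n)) (g x₀)).baseSet) :
    (tangentFrame n _ (g x) hg).det (fun i => A x (tangentFrame n _ (f x) hf i)) =
      (stdBasis n).det
        (fun i => inTangentCoordinates (𝓡 n) (𝓡 n) f g A x₀ x (stdBasis n i)) := by
  have h := ContinuousLinearMap.inCoordinates_eq (F := EuclideanSpace ℝ (Fin n))
    (E := (TangentSpace (𝓡 n) : M → Type _)) (F' := EuclideanSpace ℝ (Fin n))
    (E' := (TangentSpace (𝓡 n) : M → Type _)) (ϕ := A x) hf hg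
  refine (Module.Basis.det_map _ _ _).trans (congrArg (stdBasis n).det (funext fun i => ?_))
  exact (DFunLike.congr_fun h (stdBasis n i)).symm

/-- Pulling back a smooth family of densities along a smooth family of injective linear maps
between tangent spaces gives a smooth family of densities. -/
theorem contMDiffAt_density_pullback {f g : P → M}
    (A : P → EuclideanSpace ℝ (Fin n) →L[ℝ] EuclideanSpace ℝ (Fin n)) {x₀ : P}
    (ψ : ∀ x, DensityFiber n M (g x)) (χ : ∀ x, DensityFiber n M (f x))
    (hχ : ∀ x (v : Fin n → EuclideanSpace ℝ (Fin n)), (χ x).1 v = (ψ x).1 (fun i => A x (v i)))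
    (hA : ContMDiffAt J 𝓘(ℝ, EuclideanSpace ℝ (Fin n) →L[ℝ] EuclideanSpace ℝ (Fin n)) ∞
      (inTangentCoordinates (𝓡 n) (𝓡 n) f g A x₀) x₀)
    (hinj : Function.Injective (A x₀)) (hf : ContMDiffAt J (𝓡 n) ∞ f x₀)
    (hψ : ContMDiffAt J ((𝓡 n).prod 𝓘(ℝ, ℝ)) ∞
      (fun x => (⟨g x, ψ x⟩ : DensityBundle n M)) x₀) :
    ContMDiffAt J ((𝓡 n).prod 𝓘(ℝ, ℝ)) ∞ (fun x => (⟨f x, χ x⟩ : DensityBundle n M)) x₀ := by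
  rw [contMDiffAt_totalSpace] at hψ ⊢
  refine ⟨hf, ?_⟩
  have hg : ContMDiffAt J (𝓡 n) ∞ g x₀ := hψ.1
  have hf0 := mem_baseSet_trivializationAt (EuclideanSpace ℝ (Fin n))
    (TangentSpace (𝓡 n) : M → Type _) (f x₀)
  have hg0 := mem_baseSet_trivializationAt (EuclideanSpace ℝ (Fin n))
    (TangentSpace (𝓡 n) : M → Type _) (g x₀)
  -- Injectivity of A x₀ keeps the determinant away from 0, the only point where the absolute value
  -- fails to be smooth.
  have hne : (stdBasis n).det
      (fun i => inTangentCoordinates (𝓡 n) (𝓡 n) f g A x₀ x₀ (stdBasis n i)) ≠ 0 := by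
    rw [← tangentFrame_det_inTangentCoordinates A hf0 hg0]
    apply Module.Basis.det_ne_zero_of_linearIndependent
    exact (tangentFrame n _ (f x₀) hf0).linearIndependent.map'
      (A x₀ : EuclideanSpace ℝ (Fin n) →ₗ[ℝ] EuclideanSpace ℝ (Fin n))
      (LinearMap.ker_eq_bot.2 hinj)
  have hdet : ContMDiffAt J 𝓘(ℝ, ℝ) ∞ (fun x => |(stdBasis n).det
      (fun i => inTangentCoordinates (𝓡 n) (𝓡 n) f g A x₀ x (stdBasis n i))|) x₀ := by
    have h1 : ContDiffAt ℝ ∞ (fun x : ℝ => |x|) _ := contDiffAt_abs hne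
    exact ContMDiffAt.comp (g := fun x : ℝ => |x|) x₀ h1.contMDiffAt
      (ContMDiffAt.comp (g := fun L : EuclideanSpace ℝ (Fin n) →L[ℝ] EuclideanSpace ℝ (Fin n) =>
        (stdBasis n).det (fun i => L (stdBasis n i))) x₀
        contDiff_stdBasis_det.contDiffAt.contMDiffAt hA)
  refine (hdet.mul hψ.2).congr_of_eventuallyEq ?_
  filter_upwards [hf.continuousAt.eventually
    ((trivializationAt (EuclideanSpace ℝ (Fin n)) (TangentSpace (𝓡 n)) (f x₀)).open_baseSet.mem_nhds
      hf0), hg.continuousAt.eventually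
    ((trivializationAt (EuclideanSpace ℝ (Fin n)) (TangentSpace (𝓡 n)) (g x₀)).open_baseSet.mem_nhds
      hg0)] with x hfx hgx
  replace hgx : g x ∈ (trivializationAt (EuclideanSpace ℝ (Fin n))
    (TangentSpace (𝓡 n) : M → Type _) (g x₀)).baseSet := hgx
  rw [trivializationAt_density_apply hfx]
  simp only [Pi.mul_apply]
  rw [trivializationAt_density_apply hgx, ← tangentFrame_det_inTangentCoordinates A hfx hgx]
  exact (hχ x _).trans (Density.apply_eq (ψ x) (tangentFrame n _ (g x) hgx) _)

end DensityBundleSmoothness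

/-! ### The lifted flow on the density bundle. -/

section DensityFlowLift

open Topology

variable {n : ℕ} {M : Type*} [TopologicalSpace M] [ChartedSpace (EuclideanSpace ℝ (Fin n)) M]
  [IsManifold (𝓡 n) ∞ M] {φ : ℝ → ℝ → (M ≃ₘ⟮𝓡 n, 𝓡 n⟯ M)}

/-- The differential of `φ s t`, with values read in the model space. -/
def flowDifferential (φ : ℝ → ℝ → (M ≃ₘ⟮𝓡 n, 𝓡 n⟯ M)) (s t : ℝ) (p : M) :
    EuclideanSpace ℝ (Fin n) →L[ℝ] EuclideanSpace ℝ (Fin n) :=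
  mfderiv (𝓡 n) (𝓡 n) (φ s t) p

omit [IsManifold (𝓡 n) ∞ M] in
theorem flowDifferential_comp
    (hφ : IsSmoothTimeDepFlow (𝓡 n) (fun t s q => φ t s q)) (t₂ t₁ t₀ : ℝ) (p : M) :
    flowDifferential φ t₂ t₀ p =
      (flowDifferential φ t₂ t₁ (φ t₁ t₀ p)).comp (flowDifferential φ t₁ t₀ p) := by
  have h : (φ t₂ t₀ : M → M) = φ t₂ t₁ ∘ φ t₁ t₀ := funext fun q => (hφ.comp t₂ t₁ t₀ q).symm
  rw [flowDifferential, h]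
  exact mfderiv_comp p ((φ t₂ t₁).contMDiff.mdifferentiable (by simp) _)
    ((φ t₁ t₀).contMDiff.mdifferentiable (by simp) _)

omit [IsManifold (𝓡 n) ∞ M] in
theorem flowDifferential_self
    (hφ : IsSmoothTimeDepFlow (𝓡 n) (fun t s q => φ t s q)) (t : ℝ) (p : M) :
    flowDifferential φ t t p = .id ℝ _ := by
  have h : (φ t t : M → M) = id := funext fun q => hφ.self t q
  rw [flowDifferential, h]
  exact mfderiv_id

omit [IsManifold (𝓡 n) ∞ M] in
theorem flowDifferential_comp_inverse
    (hφ : IsSmoothTimeDepFlow (𝓡 n) (fun t s q => φ t s q)) (t s : ℝ) (p : M) :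
    (flowDifferential φ t s p).comp (flowDifferential φ s t (φ t s p)) = .id ℝ _ := by
  rw [← flowDifferential_self hφ t (φ t s p), flowDifferential_comp hφ t s t,
    show φ s t (φ t s p) = p from (hφ.comp s t s p).trans (hφ.self s p)]

/-- The inverse differential in the lift is the differential of the reversed map φ^{s,t}. Smooth
dependence on (t, s) thus needs no inversion of linear maps, and the flow laws become the chain
rule. -/
theorem densityLift_snd_apply
    (hφ : IsSmoothTimeDepFlow (𝓡 n) (fun t s q => φ t s q)) (t s : ℝ) (ψ : DensityBundle n M)
    (v : Fin n → EuclideanSpace ℝ (Fin n)) :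
    (densityLift (φ t s) ψ).2.1 v =
      ψ.2.1 (fun i => flowDifferential φ s t (φ t s ψ.1) (v i)) := by
  refine congrArg ψ.2.1 (funext fun i => ?_)
  refine (ContinuousLinearEquiv.symm_apply_eq
    ((φ t s).mfderivToContinuousLinearEquiv (by simp) ψ.1)).2 ?_
  exact (DFunLike.congr_fun (flowDifferential_comp_inverse hφ t s ψ.1) (v i)).symm

theorem isSmoothTimeDepFlow_densityLift
    (hφ : IsSmoothTimeDepFlow (𝓡 n) (fun t s q => φ t s q)) :
    IsSmoothTimeDepFlow ((𝓡 n).prod 𝓘(ℝ, ℝ)) (fun t s => densityLift (φ t s)) where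
  self t ψ := by
    refine densityBundle_mk_eq (hφ.self t ψ.1) fun v => ?_
    refine (densityLift_snd_apply hφ t t ψ v).trans ?_
    rw [flowDifferential_self hφ]
    rfl
  comp t₂ t₁ t₀ ψ := by
    refine densityBundle_mk_eq (hφ.comp t₂ t₁ t₀ ψ.1) fun v => ?_
    refine (densityLift_snd_apply hφ t₂ t₁ _ v).trans ?_
    refine (densityLift_snd_apply hφ t₁ t₀ ψ _).trans ?_
    refine Eq.trans ?_ (densityLift_snd_apply hφ t₂ t₀ ψ v).symm
    rw [flowDifferential_comp hφ t₀ t₁ t₂, show φ t₁ t₂ (φ t₂ t₀ ψ.1) = φ t₁ t₀ ψ.1 from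
      hφ.comp t₁ t₂ t₀ ψ.1, show (densityLift (φ t₁ t₀) ψ).1 = φ t₁ t₀ ψ.1 from rfl,
      show φ t₂ t₁ (φ t₁ t₀ ψ.1) = φ t₂ t₀ ψ.1 from hφ.comp t₂ t₁ t₀ ψ.1]
    rfl
  smooth := by
    intro x₀
    have hp : ContMDiff (𝓘(ℝ, ℝ).prod (𝓘(ℝ, ℝ).prod ((𝓡 n).prod 𝓘(ℝ, ℝ)))) (𝓡 n) ∞
        (fun x : ℝ × ℝ × DensityBundle n M => x.2.2.1) :=
      (contMDiff_proj (DensityFiber n M)).comp (contMDiff_snd.comp contMDiff_snd)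
    have hf : ContMDiff (𝓘(ℝ, ℝ).prod (𝓘(ℝ, ℝ).prod ((𝓡 n).prod 𝓘(ℝ, ℝ)))) (𝓡 n) ∞
        (fun x : ℝ × ℝ × DensityBundle n M => φ x.1 x.2.1 x.2.2.1) :=
      hφ.smooth.comp (contMDiff_fst.prodMk ((contMDiff_fst.comp contMDiff_snd).prodMk hp))
    have hF : ContMDiff ((𝓘(ℝ, ℝ).prod (𝓘(ℝ, ℝ).prod ((𝓡 n).prod 𝓘(ℝ, ℝ)))).prod (𝓡 n)) (𝓡 n) ∞
        (Function.uncurry fun (x : ℝ × ℝ × DensityBundle n M) (p : M) => φ x.2.1 x.1 p) :=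
      hφ.smooth.comp ((contMDiff_fst.comp (contMDiff_snd.comp contMDiff_fst)).prodMk
        ((contMDiff_fst.comp contMDiff_fst).prodMk contMDiff_snd))
    have hA := ContMDiffAt.mfderiv (x₀ := x₀) (m := ∞)
      (fun (x : ℝ × ℝ × DensityBundle n M) (p : M) => φ x.2.1 x.1 p)
      (fun x => φ x.1 x.2.1 x.2.2.1) hF.contMDiffAt hf.contMDiffAt (by simp)
    -- The differential of φ^{s,t} at φ^{t,s}(q) ends formally over φ^{s,t}(φ^{t,s}(q)); it must be
    -- seen to end over q, where ψ lives.
    have hback : (fun x : ℝ × ℝ × DensityBundle n M => φ x.2.1 x.1 (φ x.1 x.2.1 x.2.2.1)) =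
        fun x => x.2.2.1 :=
      funext fun x => (hφ.comp _ _ _ _).trans (hφ.self _ _)
    rw [hback] at hA
    refine contMDiffAt_density_pullback
      (fun x : ℝ × ℝ × DensityBundle n M => flowDifferential φ x.2.1 x.1 (φ x.1 x.2.1 x.2.2.1))
      (fun x => x.2.2.2) (fun x => (densityLift (φ x.1 x.2.1) x.2.2).2)
      (fun x v => densityLift_snd_apply hφ _ _ _ v) hA ?_ hf.contMDiffAt
      (contMDiff_snd.comp contMDiff_snd).contMDiffAt
    exact ((φ x₀.2.1 x₀.1).mfderivToContinuousLinearEquiv (by simp) _).injective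

end DensityFlowLift

/-! ### First variation of the pullbacks of a density. -/

section FamilyDerivative

open Topology

/-- Symmetry of the second derivative of G interchanges the time derivative with the space
differential. -/
theorem hasDerivAt_fderiv_of_family {E F : Type*} [NormedAddCommGroup E] [NormedSpace ℝ E]
    [NormedAddCommGroup F] [NormedSpace ℝ F] {G : ℝ × E → F} {f : E → F} {t₀ : ℝ} {y₀ : E}
    (hG : ContDiffAt ℝ 2 G (t₀, y₀))
    (hf : ∀ᶠ y in 𝓝 y₀, HasDerivAt (fun τ => G (τ, y)) (f y) t₀) :
    HasDerivAt (fun τ => fderiv ℝ (fun y => G (τ, y)) y₀) (fderiv ℝ f y₀) t₀ := by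
  have hdiff : ∀ᶠ x in 𝓝 (t₀, y₀), DifferentiableAt ℝ G x :=
    (hG.eventually (by simp)).mono fun x hx => hx.differentiableAt (by simp)
  have hD : HasFDerivAt (fderiv ℝ G) (fderiv ℝ (fderiv ℝ G) (t₀, y₀)) (t₀, y₀) :=
    ((hG.fderiv_right (m := 1) (by norm_num)).differentiableAt (by simp)).hasFDerivAt
  have hsymm := hG.isSymmSndFDerivAt (by simp)
  have htime : ∀ᶠ τ in 𝓝 t₀, fderiv ℝ (fun y => G (τ, y)) y₀ =
      (fderiv ℝ G (τ, y₀)).comp (.inr ℝ ℝ E) := by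
    have := (Continuous.prodMk_left y₀ : Continuous fun τ : ℝ => (τ, y₀)).continuousAt.eventually
      hdiff
    filter_upwards [this] with τ hτ
    exact (hτ.hasFDerivAt.comp y₀ (hasFDerivAt_prodMk_right τ y₀)).fderiv
  have hspace : f =ᶠ[𝓝 y₀] fun y => fderiv ℝ G (t₀, y) (1, 0) := by
    have := (Continuous.prodMk_right t₀ : Continuous fun y : E => (t₀, y)).continuousAt.eventually
      hdiff
    filter_upwards [this, hf] with y hy hfy
    refine hfy.unique ?_
    exact hy.hasFDerivAt.comp_hasDerivAt t₀ ((hasDerivAt_id t₀).prodMk (hasDerivAt_const t₀ y))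
  have h1 : HasDerivAt (fun τ => (fderiv ℝ G (τ, y₀)).comp (.inr ℝ ℝ E))
      ((fderiv ℝ (fderiv ℝ G) (t₀, y₀) (1, 0)).comp (.inr ℝ ℝ E)) t₀ := by
    have := hD.comp_hasDerivAt t₀ ((hasDerivAt_id t₀).prodMk (hasDerivAt_const t₀ y₀))
    exact ((ContinuousLinearMap.compL ℝ E (ℝ × E) F).flip
      (.inr ℝ ℝ E)).hasFDerivAt.comp_hasDerivAt t₀ this
  have h2 : fderiv ℝ f y₀ = (fderiv ℝ (fderiv ℝ G) (t₀, y₀) (1, 0)).comp (.inr ℝ ℝ E) := by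
    rw [hspace.fderiv_eq]
    have h3 := hD.comp y₀ (hasFDerivAt_prodMk_right t₀ y₀)
    have h4 := (ContinuousLinearMap.apply ℝ F ((1 : ℝ), (0 : E))).hasFDerivAt.comp y₀ h3
    refine h4.fderiv.trans ?_
    ext w
    exact hsymm (0, w) (1, 0)
  rw [h2]
  exact h1.congr_of_eventuallyEq htime

variable {n : ℕ} {M : Type*} [TopologicalSpace M] [ChartedSpace (EuclideanSpace ℝ (Fin n)) M]
  [IsManifold (𝓡 n) ∞ M]

/-- The differential at `p` of the chart at `q`. -/
def chartDifferential (q p : M) : EuclideanSpace ℝ (Fin n) →L[ℝ] EuclideanSpace ℝ (Fin n) :=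
  mfderiv (𝓡 n) 𝓘(ℝ, EuclideanSpace ℝ (Fin n)) (extChartAt (𝓡 n) q) p

theorem density_apply_chart {q p : M} (hp : p ∈ (chartAt (EuclideanSpace ℝ (Fin n)) q).source)
    (ψ : DensityFiber n M p) (v : Fin n → EuclideanSpace ℝ (Fin n)) :
    ψ.1 v = |(stdBasis n).det (fun i => chartDifferential q p (v i))| *
      (trivializationAt ℝ (DensityFiber n M) q ⟨p, ψ⟩).2 := by
  have hp' : p ∈ (trivializationAt (EuclideanSpace ℝ (Fin n))
      (TangentSpace (𝓡 n) : M → Type _) q).baseSet := by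
    rwa [TangentBundle.trivializationAt_baseSet]
  rw [trivializationAt_density_apply hp']
  refine (Density.apply_eq ψ (tangentFrame n _ p hp') v).trans ?_
  congr 2
  refine (Module.Basis.det_map _ _ _).trans (congrArg (stdBasis n).det (funext fun i => ?_))
  rw [chartDifferential, ← TangentBundle.continuousLinearMapAt_trivializationAt hp]
  exact congrFun (Trivialization.coe_continuousLinearEquivAt_eq (R := ℝ)
    (trivializationAt (EuclideanSpace ℝ (Fin n)) (TangentSpace (𝓡 n) : M → Type _) q) hp') (v i)

theorem HasMFDerivAt.hasDerivAt_extChartAt {q : M} {γ : ℝ → M} {t : ℝ}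
    {w : EuclideanSpace ℝ (Fin n)}
    (hγ : HasMFDerivAt 𝓘(ℝ, ℝ) (𝓡 n) γ t ((1 : ℝ →L[ℝ] ℝ).smulRight w))
    (hq : γ t ∈ (chartAt (EuclideanSpace ℝ (Fin n)) q).source) :
    HasDerivAt (fun τ => extChartAt (𝓡 n) q (γ τ)) (chartDifferential q (γ t) w) t := by
  have h1 := (mdifferentiableAt_extChartAt (I := 𝓡 n) hq).hasMFDerivAt.comp t hγ
  rw [hasMFDerivAt_iff_hasFDerivAt] at h1
  have h2 : HasFDerivAt (fun τ => extChartAt (𝓡 n) q (γ τ))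
    ((chartDifferential q (γ t)).comp ((1 : ℝ →L[ℝ] ℝ).smulRight w)) t := h1
  refine h2.hasDerivAt.congr_deriv ?_
  exact congrArg (chartDifferential q (γ t)) (one_smul ℝ w)

/-- T_q M is identified with ℝⁿ through the preferred chart at q, so a chart differential enters
only on the target side. -/
theorem fderiv_inChart {q : M} {F : M → M}
    {A : EuclideanSpace ℝ (Fin n) →L[ℝ] EuclideanSpace ℝ (Fin n)}
    (hF : HasMFDerivAt (𝓡 n) (𝓡 n) F q A)
    (hq : F q ∈ (chartAt (EuclideanSpace ℝ (Fin n)) q).source) :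
    fderiv ℝ (fun y => extChartAt (𝓡 n) q (F ((extChartAt (𝓡 n) q).symm y)))
      (extChartAt (𝓡 n) q q) = (chartDifferential q (F q)).comp A := by
  have h1 := (mdifferentiableAt_extChartAt (I := 𝓡 n) hq).hasMFDerivAt.comp q hF
  have h2 : HasFDerivWithinAt
      (fun y => extChartAt (𝓡 n) q (F ((extChartAt (𝓡 n) q).symm y)))
      ((chartDifferential q (F q)).comp A) (range (𝓡 n))
      (extChartAt (𝓡 n) q q) := h1.2
  rw [ModelWithCorners.range_eq_univ, hasFDerivWithinAt_univ] at h2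
  exact h2.fderiv

/-- The derivative of the pullbacks of a density along a smooth family of maps starting at the
identity depends only on the initial velocity field. -/
theorem exists_hasDerivAt_densityPullback {μ : ∀ q : M, DensityFiber n M q}
    (hμ : IsSmoothDensity μ) {X : ∀ q : M, TangentSpace (𝓡 n) q} (q : M) :
    ∃ K : ℝ, ∀ (F : ℝ → M → M) (t₀ : ℝ),
      ContMDiffAt (𝓘(ℝ, ℝ).prod (𝓡 n)) (𝓡 n) ∞ (fun p : ℝ × M => F p.1 p.2) (t₀, q) →
      (∀ p, F t₀ p = p) →
      (∀ p, HasMFDerivAt 𝓘(ℝ, ℝ) (𝓡 n) (fun τ => F τ p) t₀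
        ((1 : ℝ →L[ℝ] ℝ).smulRight (X p : EuclideanSpace ℝ (Fin n)))) →
      HasDerivAt (fun τ => (densityPullback (F τ) μ q).1 (stdBasis n)) K t₀ := by
  set φ := extChartAt (𝓡 n) q with hφ
  set y₀ := φ q with hy₀
  let f : EuclideanSpace ℝ (Fin n) → EuclideanSpace ℝ (Fin n) := fun y =>
    chartDifferential q (φ.symm y) (X (φ.symm y))
  let m : EuclideanSpace ℝ (Fin n) → ℝ := fun y =>
    (trivializationAt ℝ (DensityFiber n M) q ⟨φ.symm y, μ (φ.symm y)⟩).2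
  let δ : (EuclideanSpace ℝ (Fin n) →L[ℝ] EuclideanSpace ℝ (Fin n)) → ℝ := fun L =>
    |(stdBasis n).det (fun i => L (stdBasis n i))|
  have hsymm : ContMDiffAt 𝓘(ℝ, EuclideanSpace ℝ (Fin n)) (𝓡 n) ∞ φ.symm y₀ :=
    (contMDiffOn_extChartAt_symm q).contMDiffAt (extChartAt_target_mem_nhds q)
  have hsymm0 : φ.symm y₀ = q := extChartAt_to_inv q
  have hm : ContDiffAt ℝ ∞ m y₀ := by
    have h1 : ContMDiffAt (𝓡 n) 𝓘(ℝ, ℝ) ∞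
        (fun p => (trivializationAt ℝ (DensityFiber n M) q ⟨p, μ p⟩).2) q :=
      (contMDiffAt_totalSpace.1 (hμ q)).2
    have h2 : ContMDiffAt 𝓘(ℝ, EuclideanSpace ℝ (Fin n)) 𝓘(ℝ, ℝ) ∞ m y₀ :=
      ContMDiffAt.comp (g := fun p => (trivializationAt ℝ (DensityFiber n M) q ⟨p, μ p⟩).2) y₀
        (by rwa [hsymm0]) hsymm
    exact h2.contDiffAt
  have hδ : DifferentiableAt ℝ δ (.id ℝ _) := by
    have hne : (stdBasis n).det (fun i => ContinuousLinearMap.id ℝ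
        (EuclideanSpace ℝ (Fin n)) (stdBasis n i)) ≠ 0 := by
      exact ((stdBasis n).isUnit_det (stdBasis n)).ne_zero
    have h1 : ContDiffAt ℝ ∞ (fun x : ℝ => |x|) _ := contDiffAt_abs hne
    have h2 : ContDiffAt ℝ ∞ δ (.id ℝ _) :=
      ContDiffAt.comp (g := fun x : ℝ => |x|) _ h1 contDiff_stdBasis_det.contDiffAt
    exact h2.differentiableAt (by simp)
  -- In the chart, F_τ^*μ on the standard basis is δ(D_y G_τ) · m(G_τ) at y₀, with δ = |det|, m the
  -- coefficient of μ and f that of X. The witness is its product-rule derivative; it involves only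
  -- X and μ, so it can be fixed before F and t₀.
  refine ⟨fderiv ℝ δ (.id ℝ _) (fderiv ℝ f y₀) * m y₀ + δ (.id ℝ _) * fderiv ℝ m y₀ (f y₀), ?_⟩
  intro F t₀ hF h0 hX
  let G : ℝ × EuclideanSpace ℝ (Fin n) → EuclideanSpace ℝ (Fin n) := fun x =>
    φ (F x.1 (φ.symm x.2))
  have hG : ContDiffAt ℝ ∞ G (t₀, y₀) := by
    have h1 : ContMDiffAt 𝓘(ℝ, ℝ × EuclideanSpace ℝ (Fin n)) (𝓘(ℝ, ℝ).prod (𝓡 n)) ∞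
        (fun x : ℝ × EuclideanSpace ℝ (Fin n) => (x.1, φ.symm x.2)) (t₀, y₀) :=
      contDiff_fst.contMDiff.contMDiffAt.prodMk
        (ContMDiffAt.comp (g := φ.symm) (t₀, y₀) hsymm contDiff_snd.contMDiff.contMDiffAt)
    have h2 : ContMDiffAt 𝓘(ℝ, ℝ × EuclideanSpace ℝ (Fin n)) (𝓡 n) ∞
        (fun x : ℝ × EuclideanSpace ℝ (Fin n) => F x.1 (φ.symm x.2)) (t₀, y₀) :=
      ContMDiffAt.comp (g := fun p : ℝ × M => F p.1 p.2) (t₀, y₀) (by rwa [hsymm0]) h1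
    have h3 : ContMDiffAt (𝓡 n) 𝓘(ℝ, EuclideanSpace ℝ (Fin n)) ∞ φ (F t₀ (φ.symm y₀)) := by
      rw [h0, hsymm0]
      exact contMDiffAt_extChartAt
    exact (ContMDiffAt.comp (g := φ) (t₀, y₀) h3 h2).contDiffAt
  have hGderiv : ∀ᶠ y in 𝓝 y₀, HasDerivAt (fun τ => G (τ, y)) (f y) t₀ := by
    filter_upwards [extChartAt_target_mem_nhds (I := 𝓡 n) q] with y hy
    have hs : φ.symm y ∈ (chartAt (EuclideanSpace ℝ (Fin n)) q).source := by
      rw [← extChartAt_source (𝓡 n)]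
      exact φ.map_target hy
    have h1 := HasMFDerivAt.hasDerivAt_extChartAt (q := q) (hX (φ.symm y)) (by rwa [h0])
    rwa [h0] at h1
  have hGid : ∀ᶠ y in 𝓝 y₀, G (t₀, y) = y := by
    filter_upwards [extChartAt_target_mem_nhds (I := 𝓡 n) q] with y hy
    simp only [G, h0]
    exact φ.right_inv hy
  have hfd0 : fderiv ℝ (fun y => G (t₀, y)) y₀ = .id ℝ _ := by
    rw [Filter.EventuallyEq.fderiv_eq (f := fun y => y) hGid]
    exact fderiv_id
  have hfd := hasDerivAt_fderiv_of_family (hG.of_le (WithTop.coe_le_coe.2 le_top)) hGderiv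
  have hd1 : HasDerivAt (fun τ => δ (fderiv ℝ (fun y => G (τ, y)) y₀))
      (fderiv ℝ δ (.id ℝ _) (fderiv ℝ f y₀)) t₀ :=
    HasFDerivAt.comp_hasDerivAt (l := δ) t₀ (by rw [hfd0]; exact hδ.hasFDerivAt) hfd
  have hd2 : HasDerivAt (fun τ => m (G (τ, y₀))) (fderiv ℝ m y₀ (f y₀)) t₀ :=
    HasFDerivAt.comp_hasDerivAt (l := m) t₀
      (by rw [hGid.self_of_nhds]; exact (hm.differentiableAt (by simp)).hasFDerivAt)
      hGderiv.self_of_nhds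
  have hprod := hd1.mul hd2
  rw [hfd0, hGid.self_of_nhds] at hprod
  refine hprod.congr_of_eventuallyEq ?_
  have hsrc : ∀ᶠ τ in 𝓝 t₀, F τ q ∈ (chartAt (EuclideanSpace ℝ (Fin n)) q).source := by
    refine (hX q).continuousAt.eventually ?_
    change _ ∈ 𝓝 (F t₀ q)
    rw [h0]
    exact (chartAt (EuclideanSpace ℝ (Fin n)) q).open_source.mem_nhds (mem_chart_source _ q)
  have hmd : ∀ᶠ τ in 𝓝 t₀, MDifferentiableAt (𝓡 n) (𝓡 n) (F τ) q := by
    have : IsManifold (𝓡 n) 1 M := IsManifold.of_le (n := ∞) (by exact_mod_cast le_top)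
    have h1 := (contMDiffAt_iff_contMDiffAt_nhds (n := 1) (by simp)).1
      (hF.of_le (by exact_mod_cast le_top))
    have h2 := (Continuous.prodMk_left q : Continuous fun τ : ℝ => (τ, q)).continuousAt.eventually
      h1
    filter_upwards [h2] with τ hτ
    have h3 : ContMDiffAt (𝓡 n) (𝓘(ℝ, ℝ).prod (𝓡 n)) 1 (fun p : M => (τ, p)) q :=
      contMDiffAt_const.prodMk contMDiffAt_id
    exact (ContMDiffAt.comp (g := fun p : ℝ × M => F p.1 p.2) q hτ h3).mdifferentiableAt (by simp)
  filter_upwards [hsrc, hmd] with τ hτ hτd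
  have h1 := fderiv_inChart hτd.hasMFDerivAt hτ
  refine (density_apply_chart hτ (μ (F τ q)) _).trans ?_
  simp only [Pi.mul_apply]
  congr 1
  · simp only [δ, G, ← hφ, ← hy₀] at h1 ⊢
    rw [h1]
    rfl
  · have h2 : φ.symm (G (τ, y₀)) = F τ q := by
      simp only [G, hsymm0]
      exact φ.left_inv (by rwa [hφ, extChartAt_source])
    exact congrArg
      (fun p => (trivializationAt ℝ (DensityFiber n M) q ⟨p, μ p⟩).2) h2.symm

end FamilyDerivative

/-! ### The global trivialization given by a positive density. -/

section DensityRatio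

open Topology

variable {n : ℕ} {M : Type*} [TopologicalSpace M] [ChartedSpace (EuclideanSpace ℝ (Fin n)) M]
  {μ : ∀ q : M, DensityFiber n M q}

/-- The quotient `ψ / μ_q` of a density `ψ ∈ 𝒟(T_q M)` by a reference density. -/
def densityRatio (μ : ∀ q : M, DensityFiber n M q) (ψ : DensityBundle n M) : ℝ :=
  ψ.2.1 (stdBasis n) / (μ ψ.1).1 (stdBasis n)

theorem IsPositiveDensity.apply_basis_pos (hμ : IsPositiveDensity μ) (q : M)
    (e : Module.Basis (Fin n) ℝ (TangentSpace (𝓡 n) q)) : 0 < (μ q).1 e :=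
  hμ q e e.linearIndependent

theorem IsPositiveDensity.apply_stdBasis_pos (hμ : IsPositiveDensity μ) (q : M) :
    0 < (μ q).1 (stdBasis n) :=
  hμ.apply_basis_pos q (stdBasis n)

theorem IsPositiveDensity.ratio_smul (hμ : IsPositiveDensity μ) (ψ : DensityBundle n M) :
    densityRatio μ ψ • μ ψ.1 = ψ.2 := by
  ext v
  have h1 := Density.apply_eq (μ ψ.1) (stdBasis n) v
  have h2 := Density.apply_eq ψ.2 (stdBasis n) v
  have h3 := (hμ.apply_stdBasis_pos ψ.1).ne'
  have h4 : ∀ a b d : ℝ, b ≠ 0 → a / b * (d * b) = d * a := by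
    intro a b d hb
    field_simp
  rw [Density.smul_apply, h1, h2]
  exact h4 _ _ _ h3

theorem IsPositiveDensity.ratio_mk (hμ : IsPositiveDensity μ) (a : ℝ) (q : M) :
    densityRatio μ ⟨q, a • μ q⟩ = a :=
  mul_div_cancel_right₀ a (hμ.apply_stdBasis_pos q).ne'

variable [IsManifold (𝓡 n) ∞ M]

theorem contMDiff_smul_density (hs : IsSmoothDensity μ) :
    ContMDiff (𝓘(ℝ, ℝ).prod (𝓡 n)) ((𝓡 n).prod 𝓘(ℝ, ℝ)) ∞
      (fun p : ℝ × M => (⟨p.2, p.1 • μ p.2⟩ : DensityBundle n M)) := by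
  intro x₀
  rw [contMDiffAt_totalSpace]
  refine ⟨contMDiffAt_snd, ?_⟩
  have h1 : ContMDiffAt (𝓘(ℝ, ℝ).prod (𝓡 n)) 𝓘(ℝ, ℝ) ∞
      (fun p : ℝ × M => (trivializationAt ℝ (DensityFiber n M) x₀.2 ⟨p.2, μ p.2⟩).2) x₀ :=
    ContMDiffAt.comp (g := fun q => (trivializationAt ℝ (DensityFiber n M) x₀.2 ⟨q, μ q⟩).2) x₀
      (contMDiffAt_totalSpace.1 (hs x₀.2)).2 contMDiffAt_snd
  refine (contMDiffAt_fst.mul h1).congr_of_eventuallyEq ?_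
  filter_upwards [continuousAt_snd.eventually
    ((trivializationAt (EuclideanSpace ℝ (Fin n))
      (TangentSpace (𝓡 n) : M → Type _) x₀.2).open_baseSet.mem_nhds
      (mem_baseSet_trivializationAt _ _ x₀.2))] with p hp
  replace hp : p.2 ∈ (trivializationAt (EuclideanSpace ℝ (Fin n))
    (TangentSpace (𝓡 n) : M → Type _) x₀.2).baseSet := hp
  simp only [Pi.mul_apply]
  rw [trivializationAt_density_apply hp, trivializationAt_density_apply hp]
  rfl

/-- The quotient does not depend on the basis used to evaluate it, so locally it is a quotient of
bundle coordinates, with positive denominator. The standard basis in its definition need not be a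
smooth frame. -/
theorem contMDiff_densityRatio (hs : IsSmoothDensity μ) (hp : IsPositiveDensity μ) :
    ContMDiff ((𝓡 n).prod 𝓘(ℝ, ℝ)) 𝓘(ℝ, ℝ) ∞ (densityRatio μ) := by
  intro ψ₀
  have hproj : ContMDiffAt ((𝓡 n).prod 𝓘(ℝ, ℝ)) (𝓡 n) ∞ (fun ψ : DensityBundle n M => ψ.1) ψ₀ :=
    contMDiffAt_proj (DensityFiber n M)
  have h1 : ContMDiffAt ((𝓡 n).prod 𝓘(ℝ, ℝ)) 𝓘(ℝ, ℝ) ∞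
      (fun ψ : DensityBundle n M => (trivializationAt ℝ (DensityFiber n M) ψ₀.1 ψ).2) ψ₀ :=
    (contMDiffAt_totalSpace.1 contMDiffAt_id).2
  have h2 : ContMDiffAt ((𝓡 n).prod 𝓘(ℝ, ℝ)) 𝓘(ℝ, ℝ) ∞ (fun ψ : DensityBundle n M =>
      (trivializationAt ℝ (DensityFiber n M) ψ₀.1 ⟨ψ.1, μ ψ.1⟩).2) ψ₀ :=
    ContMDiffAt.comp (g := fun q => (trivializationAt ℝ (DensityFiber n M) ψ₀.1 ⟨q, μ q⟩).2) ψ₀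
      (contMDiffAt_totalSpace.1 (hs ψ₀.1)).2 hproj
  have hpos : ∀ q ∈ (trivializationAt (EuclideanSpace ℝ (Fin n))
      (TangentSpace (𝓡 n) : M → Type _) ψ₀.1).baseSet,
      0 < (trivializationAt ℝ (DensityFiber n M) ψ₀.1 ⟨q, μ q⟩).2 := by
    intro q hq
    rw [trivializationAt_density_apply hq]
    exact hp.apply_basis_pos q _
  refine (h1.div₀ h2 (hpos _ (mem_baseSet_trivializationAt _ _ ψ₀.1)).ne').congr_of_eventuallyEq ?_
  filter_upwards [hproj.continuousAt.eventually
    ((trivializationAt (EuclideanSpace ℝ (Fin n))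
      (TangentSpace (𝓡 n) : M → Type _) ψ₀.1).open_baseSet.mem_nhds
      (mem_baseSet_trivializationAt _ _ ψ₀.1))] with ψ hψ
  replace hψ : ψ.1 ∈ (trivializationAt (EuclideanSpace ℝ (Fin n))
    (TangentSpace (𝓡 n) : M → Type _) ψ₀.1).baseSet := hψ
  have h3 := hpos _ hψ
  have h4 : (trivializationAt ℝ (DensityFiber n M) ψ₀.1 ψ).2 =
      densityRatio μ ψ * (trivializationAt ℝ (DensityFiber n M) ψ₀.1 ⟨ψ.1, μ ψ.1⟩).2 := by
    have h5 : (trivializationAt ℝ (DensityFiber n M) ψ₀.1 ⟨ψ.1, ψ.2⟩).2 = _ :=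
      trivializationAt_density_apply hψ ψ.2
    refine h5.trans ?_
    rw [trivializationAt_density_apply hψ (μ ψ.1)]
    exact (congrArg (fun χ : DensityFiber n M ψ.1 => χ.1 (tangentFrame n _ ψ.1 hψ))
      (hp.ratio_smul ψ)).symm
  simp only [Pi.div_apply]
  rw [h4, mul_div_cancel_right₀ _ h3.ne']

/-- The global trivialization `(a, q) ↦ a μ_q` given by a positive density. -/
def densityDiffeomorph (hs : IsSmoothDensity μ) (hp : IsPositiveDensity μ) :
    (ℝ × M) ≃ₘ⟮𝓘(ℝ, ℝ).prod (𝓡 n), (𝓡 n).prod 𝓘(ℝ, ℝ)⟯ DensityBundle n M where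
  toFun p := ⟨p.2, p.1 • μ p.2⟩
  invFun ψ := (densityRatio μ ψ, ψ.1)
  left_inv p := Prod.ext (hp.ratio_mk p.1 p.2) rfl
  right_inv ψ := by
    change (⟨ψ.1, densityRatio μ ψ • μ ψ.1⟩ : DensityBundle n M) = ψ
    rw [hp.ratio_smul]
  contMDiff_toFun := contMDiff_smul_density hs
  contMDiff_invFun := (contMDiff_densityRatio hs hp).prodMk (contMDiff_proj (DensityFiber n M))

end DensityRatio

/-! ### The Jacobian cocycle of the flow. -/

section FlowJacobian

open Topology

variable {n : ℕ} {M : Type*} [TopologicalSpace M] [ChartedSpace (EuclideanSpace ℝ (Fin n)) M]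
  [IsManifold (𝓡 n) ∞ M] {φ : ℝ → ℝ → (M ≃ₘ⟮𝓡 n, 𝓡 n⟯ M)} {μ : ∀ q : M, DensityFiber n M q}

/-- The factor `j` in `lift (φ t s) μ_q = j μ_{φ t s q}`. -/
def flowJacobian (φ : ℝ → ℝ → (M ≃ₘ⟮𝓡 n, 𝓡 n⟯ M)) (μ : ∀ q : M, DensityFiber n M q)
    (t s : ℝ) (q : M) : ℝ :=
  densityRatio μ (densityLift (φ t s) ⟨q, μ q⟩)

theorem contMDiff_flowJacobian (hφ : IsSmoothTimeDepFlow (𝓡 n) (fun t s q => φ t s q))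
    (hs : IsSmoothDensity μ) (hp : IsPositiveDensity μ) :
    ContMDiff (𝓘(ℝ, ℝ).prod (𝓘(ℝ, ℝ).prod (𝓡 n))) 𝓘(ℝ, ℝ) ∞
      (fun x : ℝ × ℝ × M => flowJacobian φ μ x.1 x.2.1 x.2.2) := by
  have h1 : ContMDiff (𝓘(ℝ, ℝ).prod (𝓘(ℝ, ℝ).prod (𝓡 n)))
      (𝓘(ℝ, ℝ).prod (𝓘(ℝ, ℝ).prod ((𝓡 n).prod 𝓘(ℝ, ℝ)))) ∞
      (fun x : ℝ × ℝ × M => (x.1, x.2.1, (⟨x.2.2, μ x.2.2⟩ : DensityBundle n M))) :=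
    contMDiff_fst.prodMk ((contMDiff_fst.comp contMDiff_snd).prodMk
      (ContMDiff.comp hs (contMDiff_snd.comp contMDiff_snd)))
  exact (contMDiff_densityRatio hs hp).comp ((isSmoothTimeDepFlow_densityLift hφ).smooth.comp h1)

theorem densityLift_smul (hp : IsPositiveDensity μ) (t s a : ℝ) (q : M) :
    densityLift (φ t s) ⟨q, a • μ q⟩ =
      ⟨φ t s q, (a * flowJacobian φ μ t s q) • μ (φ t s q)⟩ := by
  rw [mul_smul, show flowJacobian φ μ t s q • μ (φ t s q) =
    (densityLift (φ t s) ⟨q, μ q⟩).2 from hp.ratio_smul (densityLift (φ t s) ⟨q, μ q⟩)]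
  rfl

theorem densityLift_eq (hp : IsPositiveDensity μ) (t s : ℝ) (q : M) :
    densityLift (φ t s) ⟨q, μ q⟩ = ⟨φ t s q, flowJacobian φ μ t s q • μ (φ t s q)⟩ := by
  simpa using densityLift_smul hp t s 1 q

/-- This is the composition law of the lifts, read on multiples of μ. -/
theorem flowJacobian_comp (hφ : IsSmoothTimeDepFlow (𝓡 n) (fun t s q => φ t s q))
    (hp : IsPositiveDensity μ) (t₂ t₁ t₀ : ℝ) (q : M) :
    flowJacobian φ μ t₂ t₀ q =
      flowJacobian φ μ t₁ t₀ q * flowJacobian φ μ t₂ t₁ (φ t₁ t₀ q) := by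
  rw [flowJacobian, ← (isSmoothTimeDepFlow_densityLift hφ).comp t₂ t₁ t₀, densityLift_eq hp,
    densityLift_smul hp, hp.ratio_mk]

theorem flowJacobian_self (hφ : IsSmoothTimeDepFlow (𝓡 n) (fun t s q => φ t s q))
    (hp : IsPositiveDensity μ) (t : ℝ) (q : M) : flowJacobian φ μ t t q = 1 := by
  rw [flowJacobian, (isSmoothTimeDepFlow_densityLift hφ).self]
  exact div_self (hp.apply_stdBasis_pos q).ne'

/-- Pulling back along φ^{s,t} is lifting by its inverse φ^{t,s}; hence the reversed times in the
Jacobian. -/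
theorem densityPullback_smul_apply (hφ : IsSmoothTimeDepFlow (𝓡 n) (fun t s q => φ t s q))
    (hp : IsPositiveDensity μ) (ρ : M → ℝ) (s t : ℝ) (q : M) :
    densityPullback (φ s t) (fun p => ρ p • μ p) q =
      (ρ (φ s t q) * flowJacobian φ μ t s (φ s t q)) • μ q := by
  ext v
  have hback : φ t s (φ s t q) = q := (hφ.comp t s t q).trans (hφ.self t q)
  have h1 := densityLift_snd_apply hφ t s ⟨φ s t q, μ (φ s t q)⟩ v
  rw [densityLift_eq hp] at h1
  have h2 : flowJacobian φ μ t s (φ s t q) * (μ (φ t s (φ s t q))).1 v =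
    (μ (φ s t q)).1 (fun i => flowDifferential φ s t (φ t s (φ s t q)) (v i)) := h1
  rw [hback] at h2
  refine (congrArg (fun x => ρ (φ s t q) * x) h2.symm).trans ?_
  exact (mul_assoc _ _ _).symm

theorem densityPullback_flow (hφ : IsSmoothTimeDepFlow (𝓡 n) (fun t s q => φ t s q))
    (hp : IsPositiveDensity μ) (s t : ℝ) (q : M) :
    densityPullback (φ s t) μ q = flowJacobian φ μ t s (φ s t q) • μ q := by
  simpa using densityPullback_smul_apply hφ hp (fun _ => 1) s t q

theorem flowJacobian_mul_inverse (hφ : IsSmoothTimeDepFlow (𝓡 n) (fun t s q => φ t s q))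
    (hp : IsPositiveDensity μ) (s t : ℝ) (q : M) :
    flowJacobian φ μ s t q * flowJacobian φ μ t s (φ s t q) = 1 := by
  rw [← flowJacobian_comp hφ hp, flowJacobian_self hφ hp]

end FlowJacobian

/-! ### The divergence as the logarithmic derivative of the Jacobian. -/

section Divergence

open Topology

variable {n : ℕ} {M : Type*} [TopologicalSpace M] [T2Space M]
  [ChartedSpace (EuclideanSpace ℝ (Fin n)) M]
  [IsManifold (𝓡 n) ∞ M] {φ : ℝ → ℝ → (M ≃ₘ⟮𝓡 n, 𝓡 n⟯ M)} {μ : ∀ q : M, DensityFiber n M q}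
  {X : ℝ → ∀ q : M, TangentSpace (𝓡 n) q}

omit [T2Space M] [IsManifold (𝓡 n) ∞ M] in
theorem IsDivergenceAt.divergence_spec {Y : ∀ q : M, TangentSpace (𝓡 n) q} {q : M} {c : ℝ}
    (h : IsDivergenceAt μ Y q c) : IsDivergenceAt μ Y q (divergence μ Y q) :=
  Classical.epsilon_spec (p := fun c => IsDivergenceAt μ Y q c) ⟨c, h⟩

omit [T2Space M] [IsManifold (𝓡 n) ∞ M] in
theorem IsDivergenceAt.eq {Y : ∀ q : M, TangentSpace (𝓡 n) q} {q : M} {c c' : ℝ}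
    (hp : IsPositiveDensity μ) (h : IsDivergenceAt μ Y q c) (h' : IsDivergenceAt μ Y q c') :
    c = c' :=
  mul_right_cancel₀ (hp.apply_stdBasis_pos q).ne' ((h (stdBasis n)).unique (h' (stdBasis n)))

/-- The local flow of the frozen field X_t and the family τ ↦ φ^{τ,t} both start at the identity
with velocity X_t, so their pullbacks of μ have the same derivative K. The first gives the
divergence, the second ties it to the Jacobian. -/
theorem divergence_aux (hX : IsSmoothTimeDepField (𝓡 n) X)
    (hφ : IsSmoothTimeDepFlow (𝓡 n) (fun t s q => φ t s q))
    (hφX : ∀ s q, IsTimeDepIntegralCurve (𝓡 n) X (fun t => φ t s q))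
    (hs : IsSmoothDensity μ) (hp : IsPositiveDensity μ) (t : ℝ) (q : M) :
    IsDivergenceAt μ (X t) q (divergence μ (X t) q) ∧
      HasDerivAt (fun τ => flowJacobian φ μ t τ (φ τ t q)) (divergence μ (X t) q) t := by
  have hXt : ContMDiff (𝓡 n) (𝓡 n).tangent ∞
      (fun p => (⟨p, X t p⟩ : TangentBundle (𝓡 n) M)) := by
    have h1 : ContMDiff (𝓡 n) (𝓘(ℝ, ℝ).prod (𝓡 n)) ∞ (fun p : M => (t, p)) :=
      contMDiff_const.prodMk contMDiff_id
    exact ContMDiff.comp hX h1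
  obtain ⟨K, hK⟩ := exists_hasDerivAt_densityPullback hs (X := X t) q
  have hloc := followsIntegralCurves_localFlow hXt
  have h1 := hK (localFlow (𝓡 n) (X t)) 0 (hloc.contMDiffAt hXt q) (hloc.zero_apply hXt)
    (hloc.hasMFDerivAt_zero hXt)
  have h2 := hK (fun τ => φ τ t) t
    (by
      have h3 : ContMDiff (𝓘(ℝ, ℝ).prod (𝓡 n)) (𝓘(ℝ, ℝ).prod (𝓘(ℝ, ℝ).prod (𝓡 n))) ∞
        (fun p : ℝ × M => (p.1, t, p.2)) :=
          contMDiff_fst.prodMk (contMDiff_const.prodMk contMDiff_snd)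
      exact (hφ.smooth.comp h3).contMDiffAt)
    (hφ.self t)
    (fun p => by
      have h4 := hφX t p t
      have h5 : (X t (φ t t p) : EuclideanSpace ℝ (Fin n)) = X t p :=
        congrArg (fun p => (X t p : EuclideanSpace ℝ (Fin n))) (hφ.self t p)
      exact h4.congr_mfderiv
        (congrArg (fun w => (1 : ℝ →L[ℝ] ℝ).smulRight (w : EuclideanSpace ℝ (Fin n))) h5))
  have hpos := (hp.apply_stdBasis_pos q).ne'
  have hdiv : IsDivergenceAt μ (X t) q (K / (μ q).1 (stdBasis n)) := by
    intro v
    have h3 := h1.const_mul |(stdBasis n).det v|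
    have h4 : (K / (μ q).1 (stdBasis n)) * (μ q).1 v = |(stdBasis n).det v| * K := by
      have h6 : (μ q).1 v = |(stdBasis n).det v| * (μ q).1 (stdBasis n) :=
        Density.apply_eq (μ q) (stdBasis n) v
      rw [h6]
      field_simp
    rw [h4]
    refine h3.congr_of_eventuallyEq (Filter.Eventually.of_forall fun τ => ?_)
    exact Density.apply_eq (densityPullback (localFlow (𝓡 n) (X t) τ) μ q) (stdBasis n) v
  -- Positivity of μ makes the divergence constant unique, so the chosen value is K / μ_q(e) for the
  -- standard basis e.
  rw [hdiv.divergence_spec.eq hp hdiv]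
  refine ⟨hdiv, ?_⟩
  refine (h2.div_const ((μ q).1 (stdBasis n))).congr_of_eventuallyEq
    (Filter.Eventually.of_forall fun τ => ?_)
  simp only
  rw [densityPullback_flow hφ hp]
  exact (mul_div_cancel_right₀ _ hpos).symm

theorem contMDiff_deriv_param {EP : Type*} [NormedAddCommGroup EP] [NormedSpace ℝ EP] {HP : Type*}
    [TopologicalSpace HP] {J : ModelWithCorners ℝ EP HP} {P : Type*} [TopologicalSpace P]
    [ChartedSpace HP P] [IsManifold J ∞ P] {g : P → ℝ → ℝ} {h : P → ℝ}
    (hg : ContMDiff (J.prod 𝓘(ℝ, ℝ)) 𝓘(ℝ, ℝ) ∞ (Function.uncurry g))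
    (hh : ContMDiff J 𝓘(ℝ, ℝ) ∞ h) :
    ContMDiff J 𝓘(ℝ, ℝ) ∞ (fun p => deriv (g p) (h p)) := by
  intro x₀
  have h1 := ContMDiffAt.mfderiv (x₀ := x₀) (m := ∞) g h hg.contMDiffAt hh.contMDiffAt (by simp)
  have h2 : inTangentCoordinates 𝓘(ℝ, ℝ) 𝓘(ℝ, ℝ) h (fun p => g p (h p))
      (fun p => (mfderiv 𝓘(ℝ, ℝ) 𝓘(ℝ, ℝ) (g p) (h p) : ℝ →L[ℝ] ℝ)) x₀ =
      fun p => fderiv ℝ (g p) (h p) :=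
    (inTangentCoordinates_model_space _ _ _ _).trans (funext fun p => mfderiv_eq_fderiv)
  have h3 : ContMDiffAt J 𝓘(ℝ, ℝ →L[ℝ] ℝ) ∞ (fun p => fderiv ℝ (g p) (h p)) x₀ := by
    rw [← h2]
    exact h1
  exact h3.clm_apply contMDiffAt_const

/-- The divergence is a τ-derivative of the jointly smooth Jacobian, so no joint smoothness in t of
the local flows of the X_t is needed. -/
theorem contMDiff_divergence (hX : IsSmoothTimeDepField (𝓡 n) X)
    (hφ : IsSmoothTimeDepFlow (𝓡 n) (fun t s q => φ t s q))
    (hφX : ∀ s q, IsTimeDepIntegralCurve (𝓡 n) X (fun t => φ t s q))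
    (hs : IsSmoothDensity μ) (hp : IsPositiveDensity μ) :
    ContMDiff (𝓘(ℝ, ℝ).prod (𝓡 n)) 𝓘(ℝ, ℝ) ∞ (fun p : ℝ × M => divergence μ (X p.1) p.2) := by
  have h1 : ContMDiff ((𝓘(ℝ, ℝ).prod (𝓡 n)).prod 𝓘(ℝ, ℝ)) (𝓡 n) ∞
      (fun x : (ℝ × M) × ℝ => φ x.2 x.1.1 x.1.2) :=
    hφ.smooth.comp (contMDiff_snd.prodMk contMDiff_fst)
  have h2 : ContMDiff ((𝓘(ℝ, ℝ).prod (𝓡 n)).prod 𝓘(ℝ, ℝ)) 𝓘(ℝ, ℝ) ∞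
      (Function.uncurry fun (p : ℝ × M) τ => flowJacobian φ μ p.1 τ (φ τ p.1 p.2)) :=
    ContMDiff.comp (g := fun x : ℝ × ℝ × M => flowJacobian φ μ x.1 x.2.1 x.2.2)
      (f := fun x : (ℝ × M) × ℝ => (x.1.1, x.2, φ x.2 x.1.1 x.1.2))
      (contMDiff_flowJacobian hφ hs hp)
      ((contMDiff_fst.comp contMDiff_fst).prodMk (contMDiff_snd.prodMk h1))
  have h3 : ContMDiff (𝓘(ℝ, ℝ).prod (𝓡 n)) 𝓘(ℝ, ℝ) ∞ (fun p : ℝ × M =>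
      deriv (fun τ => flowJacobian φ μ p.1 τ (φ τ p.1 p.2)) p.1) :=
    contMDiff_deriv_param (g := fun (p : ℝ × M) τ => flowJacobian φ μ p.1 τ (φ τ p.1 p.2))
      (h := fun p => p.1) h2 contMDiff_fst
  refine h3.congr fun p => ?_
  exact ((divergence_aux hX hφ hφX hs hp p.1 p.2).2.deriv).symm

/-- By the cocycle law this Jacobian is the reciprocal of the one in `divergence_aux`; both equal 1
at τ = t, so the derivative changes sign. -/
theorem hasDerivAt_flowJacobian_self (hX : IsSmoothTimeDepField (𝓡 n) X)
    (hφ : IsSmoothTimeDepFlow (𝓡 n) (fun t s q => φ t s q))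
    (hφX : ∀ s q, IsTimeDepIntegralCurve (𝓡 n) X (fun t => φ t s q))
    (hs : IsSmoothDensity μ) (hp : IsPositiveDensity μ) (t : ℝ) (q : M) :
    HasDerivAt (fun τ => flowJacobian φ μ τ t q) (-divergence μ (X t) q) t := by
  have h1 := (divergence_aux hX hφ hφX hs hp t q).2
  have h2 : flowJacobian φ μ t t (φ t t q) = 1 := flowJacobian_self hφ hp t _
  have h3 := h1.fun_inv (by rw [h2]; exact one_ne_zero)
  rw [h2, one_pow, div_one] at h3
  refine h3.congr_of_eventuallyEq (Filter.Eventually.of_forall fun τ => ?_)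
  exact eq_inv_of_mul_eq_one_left (flowJacobian_mul_inverse hφ hp τ t q)

theorem hasDerivAt_flowJacobian (hX : IsSmoothTimeDepField (𝓡 n) X)
    (hφ : IsSmoothTimeDepFlow (𝓡 n) (fun t s q => φ t s q))
    (hφX : ∀ s q, IsTimeDepIntegralCurve (𝓡 n) X (fun t => φ t s q))
    (hs : IsSmoothDensity μ) (hp : IsPositiveDensity μ) (t s : ℝ) (q : M) :
    HasDerivAt (fun τ => flowJacobian φ μ τ s q)
      (flowJacobian φ μ t s q * -divergence μ (X t) (φ t s q)) t := by
  have h1 := (hasDerivAt_flowJacobian_self hX hφ hφX hs hp t (φ t s q)).const_mul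
    (flowJacobian φ μ t s q)
  refine h1.congr_of_eventuallyEq (Filter.Eventually.of_forall fun τ => ?_)
  exact flowJacobian_comp hφ hp τ t s q

/-- Along a trajectory j' = -div · j with j = 1 at time s; multiplying by the integrating factor exp
∫ div gives a constant. -/
theorem flowJacobian_eq_exp (hX : IsSmoothTimeDepField (𝓡 n) X)
    (hφ : IsSmoothTimeDepFlow (𝓡 n) (fun t s q => φ t s q))
    (hφX : ∀ s q, IsTimeDepIntegralCurve (𝓡 n) X (fun t => φ t s q))
    (hs : IsSmoothDensity μ) (hp : IsPositiveDensity μ) (t s : ℝ) (q : M) :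
    flowJacobian φ μ t s q =
      Real.exp (-∫ τ in s..t, divergence μ (X τ) (φ τ s q)) := by
  have hcont : Continuous fun τ => divergence μ (X τ) (φ τ s q) := by
    have h1 : Continuous fun τ => (τ, φ τ s q) :=
      continuous_id.prodMk (hφ.contMDiff_time s q).continuous
    exact (contMDiff_divergence hX hφ hφX hs hp).continuous.comp h1
  have hd : ∀ τ, HasDerivAt (fun τ => flowJacobian φ μ τ s q *
      Real.exp (∫ τ in s..τ, divergence μ (X τ) (φ τ s q))) 0 τ := by
    intro τ
    have h1 := (hasDerivAt_flowJacobian hX hφ hφX hs hp τ s q).mul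
      (hcont.integral_hasStrictDerivAt s τ).hasDerivAt.exp
    exact h1.congr_deriv (by ring)
  have hconst := is_const_of_deriv_eq_zero (fun τ => (hd τ).differentiableAt)
    (fun τ => (hd τ).deriv) t s
  simp only [intervalIntegral.integral_same, Real.exp_zero, mul_one,
    flowJacobian_self hφ hp] at hconst
  rw [Real.exp_neg]
  exact eq_inv_of_mul_eq_one_left hconst

/-- The trivialization sends the curve τ ↦ (a · j(τ,t,q), φ^{τ,t}(q)) to the lifted trajectory of
aμ_q. Both sides are the velocity of that trajectory at τ = t. -/
theorem mfderiv_densityDiffeomorph (hX : IsSmoothTimeDepField (𝓡 n) X)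
    (hφ : IsSmoothTimeDepFlow (𝓡 n) (fun t s q => φ t s q))
    (hφX : ∀ s q, IsTimeDepIntegralCurve (𝓡 n) X (fun t => φ t s q))
    (hs : IsSmoothDensity μ) (hp : IsPositiveDensity μ) (t a : ℝ) (q : M) :
    mfderiv (𝓘(ℝ, ℝ).prod (𝓡 n)) ((𝓡 n).prod 𝓘(ℝ, ℝ)) (densityDiffeomorph hs hp) (a, q)
        ((-(a * divergence μ (X t) q), X t q) : ℝ × TangentSpace (𝓡 n) q) =
      flowGenerator ((𝓡 n).prod 𝓘(ℝ, ℝ)) (fun t s => densityLift (φ t s)) t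
        (densityDiffeomorph hs hp (a, q)) := by
  have hJ := (hasDerivAt_flowJacobian_self hX hφ hφX hs hp t q).const_mul a
  have hself : (a * flowJacobian φ μ t t q, φ t t q) = (a, q) := by
    rw [flowJacobian_self hφ hp, mul_one]
    exact Prod.ext rfl (hφ.self t q)
  have hXq : (X t (φ t t q) : EuclideanSpace ℝ (Fin n)) = X t q :=
    congrArg (fun p => (X t p : EuclideanSpace ℝ (Fin n))) (hφ.self t q)
  have h1 := hJ.hasFDerivAt.hasMFDerivAt.prodMk (hφX t q t)
  have hΨ : HasMFDerivAt (𝓘(ℝ, ℝ).prod (𝓡 n)) ((𝓡 n).prod 𝓘(ℝ, ℝ)) (densityDiffeomorph hs hp)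
      (a * flowJacobian φ μ t t q, φ t t q)
      (mfderiv (𝓘(ℝ, ℝ).prod (𝓡 n)) ((𝓡 n).prod 𝓘(ℝ, ℝ)) (densityDiffeomorph hs hp) (a, q) :
        ℝ × EuclideanSpace ℝ (Fin n) →L[ℝ] EuclideanSpace ℝ (Fin n) × ℝ) := by
    rw [hself]
    exact ((densityDiffeomorph hs hp).contMDiff.mdifferentiable (by simp) (a, q)).hasMFDerivAt
  have h2 := HasMFDerivAt.comp t hΨ h1
  have hcurve : (densityDiffeomorph hs hp ∘ fun τ => (a * flowJacobian φ μ τ t q, φ τ t q)) =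
      fun τ => densityLift (φ τ t) (densityDiffeomorph hs hp (a, q)) :=
    funext fun τ => (densityLift_smul hp τ t a q).symm
  rw [hcurve] at h2
  have h3 : (mfderiv 𝓘(ℝ, ℝ) ((𝓡 n).prod 𝓘(ℝ, ℝ))
      (fun τ => densityLift (φ τ t) (densityDiffeomorph hs hp (a, q))) t :
        ℝ →L[ℝ] EuclideanSpace ℝ (Fin n) × ℝ) 1 = _ := DFunLike.congr_fun h2.mfderiv (1 : ℝ)
  refine Eq.trans ?_ h3.symm
  refine congrArg (mfderiv (𝓘(ℝ, ℝ).prod (𝓡 n)) ((𝓡 n).prod 𝓘(ℝ, ℝ))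
    (densityDiffeomorph hs hp) (a, q) :
      ℝ × EuclideanSpace ℝ (Fin n) →L[ℝ] EuclideanSpace ℝ (Fin n) × ℝ) ?_
  refine Prod.ext ?_ ?_
  · change -(a * divergence μ (X t) q) = (1 : ℝ) • (a * -divergence μ (X t) q)
    rw [one_smul, mul_neg]
  · change (X t q : EuclideanSpace ℝ (Fin n)) =
      (1 : ℝ) • (X t (φ t t q) : EuclideanSpace ℝ (Fin n))
    rw [hXq]
    exact (one_smul ℝ (X t q : EuclideanSpace ℝ (Fin n))).symm

/-- The time-dependent flow of a complete field, as a family of diffeomorphisms. -/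
def timeDepFlowDiffeomorph (hX : IsSmoothTimeDepField (𝓡 n) X) (hc : IsCompleteField (𝓡 n) X)
    (t s : ℝ) : M ≃ₘ⟮𝓡 n, 𝓡 n⟯ M where
  toFun := timeDepFlow (𝓡 n) X hc t s
  invFun := timeDepFlow (𝓡 n) X hc s t
  left_inv q := (timeDepFlow_comp hX hc s t s q).trans (timeDepFlow_self hc s q)
  right_inv q := (timeDepFlow_comp hX hc t s t q).trans (timeDepFlow_self hc t q)
  contMDiff_toFun := (isSmoothTimeDepFlow_timeDepFlow hX hc).contMDiff_map t s
  contMDiff_invFun := (isSmoothTimeDepFlow_timeDepFlow hX hc).contMDiff_map s t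

end Divergence

end

/-! ### Assembly of the three statements. -/

theorem mainTheorem3 (n : ℕ) (M : Type*) [TopologicalSpace M] [T2Space M]
    [SecondCountableTopology M] [ChartedSpace (EuclideanSpace ℝ (Fin n)) M]
    [IsManifold (𝓡 n) ∞ M]
    (X : ℝ → ∀ q : M, TangentSpace (𝓡 n) q)
    (hX : IsSmoothTimeDepField (𝓡 n) X) (hc : IsCompleteField (𝓡 n) X) :
    -- the flow maps `φ^{t,s}` of `X` are diffeomorphisms and form a smooth time-dependent flow
    ∃ φ : ℝ → ℝ → (M ≃ₘ⟮𝓡 n, 𝓡 n⟯ M),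
      (∀ (t s : ℝ) (q : M), φ t s q = timeDepFlow (𝓡 n) X hc t s q) ∧
      IsSmoothTimeDepFlow (𝓡 n) (fun t s q => φ t s q) ∧
      -- their lifts form a smooth time-dependent flow on the density bundle
      IsSmoothTimeDepFlow ((𝓡 n).prod 𝓘(ℝ, ℝ)) (fun t s => densityLift (φ t s)) ∧
      -- which has a smooth infinitesimal generator, and is the flow of that generator
      ∃ Xlift : ℝ → ∀ ψ : DensityBundle n M, TangentSpace ((𝓡 n).prod 𝓘(ℝ, ℝ)) ψ,
        IsSmoothTimeDepField ((𝓡 n).prod 𝓘(ℝ, ℝ)) Xlift ∧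
        IsInfinitesimalGenerator ((𝓡 n).prod 𝓘(ℝ, ℝ)) (fun t s => densityLift (φ t s)) Xlift ∧
        (∀ (s : ℝ) (ψ : DensityBundle n M),
          IsTimeDepIntegralCurve ((𝓡 n).prod 𝓘(ℝ, ℝ)) Xlift
            (fun t => densityLift (φ t s) ψ)) ∧
        ∀ μ : ∀ q : M, DensityFiber n M q, IsSmoothDensity μ → IsPositiveDensity μ →
          -- the divergences `div_μ X_t` exist and depend smoothly on `(t, q)`
          (∀ (t : ℝ) (q : M), IsDivergenceAt μ (X t) q (divergence μ (X t) q)) ∧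
          ContMDiff (𝓘(ℝ, ℝ).prod (𝓡 n)) 𝓘(ℝ, ℝ) ∞
            (fun p : ℝ × M => divergence μ (X p.1) p.2) ∧
          -- the generator in the global trivialization `(a, q) ↦ a μ_q`
          (∃ Ψ : (ℝ × M) ≃ₘ⟮𝓘(ℝ, ℝ).prod (𝓡 n), (𝓡 n).prod 𝓘(ℝ, ℝ)⟯ DensityBundle n M,
            (∀ (a : ℝ) (q : M), Ψ (a, q) = ⟨q, a • μ q⟩) ∧
            ∀ (t a : ℝ) (q : M),
              mfderiv (𝓘(ℝ, ℝ).prod (𝓡 n)) ((𝓡 n).prod 𝓘(ℝ, ℝ)) Ψ (a, q)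
                  ((-(a * divergence μ (X t) q), X t q) : ℝ × TangentSpace (𝓡 n) q) =
                Xlift t (Ψ (a, q))) ∧
          -- the transformed densities along the trajectories
          ∀ ρ₀ : M → ℝ, ContMDiff (𝓡 n) 𝓘(ℝ, ℝ) ∞ ρ₀ →
            ∃ ρ : ℝ → M → ℝ,
              (∀ (t : ℝ) (q : M),
                ρ t q • μ q = densityPullback (φ 0 t) (fun p => ρ₀ p • μ p) q) ∧
              (∀ ρ' : ℝ → M → ℝ,
                (∀ (t : ℝ) (q : M),
                  ρ' t q • μ q = densityPullback (φ 0 t) (fun p => ρ₀ p • μ p) q) → ρ' = ρ) ∧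
              ContMDiff (𝓘(ℝ, ℝ).prod (𝓡 n)) 𝓘(ℝ, ℝ) ∞ (fun p : ℝ × M => ρ p.1 p.2) ∧
              (∀ (t : ℝ) (q : M),
                ρ t (φ t 0 q) =
                  Real.exp (-∫ s in (0 : ℝ)..t, divergence μ (X s) (φ s 0 q)) * ρ₀ q) ∧
              (∀ (t : ℝ) (q : M), 0 < ρ₀ q →
                0 < ρ t (φ t 0 q) ∧
                Real.log (ρ t (φ t 0 q)) =
                  Real.log (ρ₀ q) - ∫ s in (0 : ℝ)..t, divergence μ (X s) (φ s 0 q)) := by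
  have hflow := isSmoothTimeDepFlow_timeDepFlow hX hc
  have hcurve := isTimeDepIntegralCurve_timeDepFlow (I := 𝓡 n) hc
  obtain ⟨φ, hφ⟩ : ∃ φ : ℝ → ℝ → (M ≃ₘ⟮𝓡 n, 𝓡 n⟯ M),
      ∀ t s q, φ t s q = timeDepFlow (𝓡 n) X hc t s q :=
    ⟨timeDepFlowDiffeomorph hX hc, fun _ _ _ => rfl⟩
  have hφflow : IsSmoothTimeDepFlow (𝓡 n) (fun t s q => φ t s q) := by
    simp only [hφ]
    exact hflow
  have hφX : ∀ s q, IsTimeDepIntegralCurve (𝓡 n) X (fun t => φ t s q) := by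
    simp only [hφ]
    exact hcurve
  have hlift := isSmoothTimeDepFlow_densityLift hφflow
  refine ⟨φ, hφ, hφflow, hlift, flowGenerator _ (fun t s => densityLift (φ t s)),
    hlift.isSmoothTimeDepField, hlift.isInfinitesimalGenerator, hlift.isTimeDepIntegralCurve,
    fun μ hs hp => ?_⟩
  refine ⟨fun t q => (divergence_aux hX hφflow hφX hs hp t q).1,
    contMDiff_divergence hX hφflow hφX hs hp,
    ⟨densityDiffeomorph hs hp, fun _ _ => rfl,
      mfderiv_densityDiffeomorph hX hφflow hφX hs hp⟩, fun ρ₀ hρ₀ => ?_⟩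
  have hforward : ∀ t q, φ 0 t (φ t 0 q) = q := fun t q =>
    (hφflow.comp 0 t 0 q).trans (hφflow.self 0 q)
  have hformula : ∀ t q, ρ₀ (φ 0 t (φ t 0 q)) * flowJacobian φ μ t 0 (φ 0 t (φ t 0 q)) =
      Real.exp (-∫ s in (0 : ℝ)..t, divergence μ (X s) (φ s 0 q)) * ρ₀ q := by
    intro t q
    rw [hforward, flowJacobian_eq_exp hX hφflow hφX hs hp, mul_comm]
  refine ⟨fun t q => ρ₀ (φ 0 t q) * flowJacobian φ μ t 0 (φ 0 t q),
    fun t q => (densityPullback_smul_apply hφflow hp ρ₀ 0 t q).symm, fun ρ' hρ' => ?_, ?_,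
    hformula, fun t q hq => ?_⟩
  -- Dividing by the nowhere vanishing μ recovers the coefficient, which forces uniqueness.
  · funext t q
    have h1 := (hρ' t q).trans (densityPullback_smul_apply hφflow hp ρ₀ 0 t q)
    have h2 := congrArg (fun ψ => densityRatio μ ⟨q, ψ⟩) h1
    simpa only [hp.ratio_mk] using h2
  · have h1 : ContMDiff (𝓘(ℝ, ℝ).prod (𝓡 n)) (𝓡 n) ∞ (fun p : ℝ × M => φ 0 p.1 p.2) :=
      ContMDiff.comp (g := fun x : ℝ × ℝ × M => φ x.1 x.2.1 x.2.2)
        (f := fun p : ℝ × M => ((0 : ℝ), p)) hφflow.smooth (contMDiff_const.prodMk contMDiff_id)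
    have h2 : ContMDiff (𝓘(ℝ, ℝ).prod (𝓡 n)) 𝓘(ℝ, ℝ) ∞
        (fun p : ℝ × M => flowJacobian φ μ p.1 0 (φ 0 p.1 p.2)) :=
      ContMDiff.comp (g := fun x : ℝ × ℝ × M => flowJacobian φ μ x.1 x.2.1 x.2.2)
        (f := fun p : ℝ × M => (p.1, (0 : ℝ), φ 0 p.1 p.2)) (contMDiff_flowJacobian hφflow hs hp)
        (contMDiff_fst.prodMk (contMDiff_const.prodMk h1))
    exact (hρ₀.comp h1).mul h2
  · refine ⟨?_, ?_⟩
    · simp only [hformula]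
      positivity
    · simp only [hformula]
      rw [Real.log_mul (Real.exp_pos _).ne' hq.ne', Real.log_exp]
      ring
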